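/- Call a finite graph $\Gamma$ *separating* if $\omega(\Gamma)\,\alpha(\Gamma)<|V(\Gamma)|$, where $\omega(\Gamma)$ and $\alpha(\Gamma)$ are the largest sizes of a clique and of a coclique of $\Gamma$, and *non-separating* otherwise. A *polar space of rank $n$* is a set of points together with a family of sets of points, called subspaces, that satisfies the axioms of Tits: (P1) each subspace, together with the subspaces contained in it, is a projective space of dimension at most $n-1$ (lines with exactly two points are allowed); (P2) the intersection of two subspaces is a subspace; (P3) for each subspace $V$ of dimension $n-1$ and each point $p\notin V$ there is a unique subspace $W\ni p$ with $\dim(V\cap W)=n-2$, and $W$ contains all points of $V$ that are on a line with $p$; (P4) there are two disjoint subspaces of dimension $n-1$. The subspaces of dimension $n-1$ are called *generators*. The polar space has *order* $(q,t)$ if each line has exactly $q+1$ points and each subspace of dimension $n-2$ is contained in exactly $t+1$ generators. Its *polar graph* has the points as vertices, two distinct points being adjacent if they are on a common line. An *ovoid* is a set of points that meets every generator in exactly one point. The *dual polar graph* has the generators as vertices, two of them being adjacent if they meet in a subspace of dimension $n-2$. The *distance-2 graph* of a graph has the same vertices, two of them being adjacent if they are at distance $2$ in the graph. (a) For $n\ge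 4$, the triangular graph $T_n$ (the line graph of the complete graph $K_n$) is separating if and only if $n$ is odd. (b) Let $\mathcal{P}$ be a finite polar space of rank $n\ge 2$ that has an order $(q,t)$ (for example a finite classical polar space of rank at least $2$, or the dual of one of rank $2$). Then the polar graph of $\mathcal{P}$ is non-separating if and only if $\mathcal{P}$ has an ovoid. (c) Let $\mathcal{P}$ be a finite polar space of rank $5$ and order $(q,1)$. Then every connected component of the distance-2 graph of the dual polar graph of $\mathcal{P}$ is separating. -/

import Mathlib

/-- A graph is separating if the product of its clique number and its coclique number is strictly
less than its number of vertices. -/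
def IsSeparating {V : Type*} (G : SimpleGraph V) : Prop :=
  G.cliqueNum * G.indepNum < Nat.card V

/-- The triangular graph `T_n`: the line graph of the complete graph on `n` vertices. -/
def triangularGraph (n : ℕ) : SimpleGraph ((⊤ : SimpleGraph (Fin n)).edgeSet) :=
  (⊤ : SimpleGraph (Fin n)).lineGraph

/-- The distance-2 graph of a graph. -/
def distanceTwoGraph {V : Type*} (G : SimpleGraph V) : SimpleGraph V where
  Adj x y := G.dist x y = 2
  symm := ⟨fun x y h => by rw [SimpleGraph.dist_comm]; exact h⟩
  loopless := ⟨fun x h => by simp at h⟩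

/-- The axioms of Veblen and Young for a projective space with point set `V` and the given lines
(lines with exactly two points are allowed). -/
structure IsProjectiveSpace {P : Type*} (V : Set P) (lines : Set (Set P)) : Prop where
  subset : ∀ L ∈ lines, L ⊆ V
  nontrivial : ∀ L ∈ lines, L.Nontrivial
  existsUnique_line : ∀ x ∈ V, ∀ y ∈ V, x ≠ y → ∃! L, L ∈ lines ∧ x ∈ L ∧ y ∈ L
  /-- Two lines `M = yz` and `N = uv` that both cross two intersecting lines `A`, `B` away from
  the intersection point `x` have a point in common. -/
  veblen : ∀ A ∈ lines, ∀ B ∈ lines, ∀ M ∈ lines, ∀ N ∈ lines, A ≠ B →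
    ∀ x ∈ A ∩ B, ∀ y ∈ A, ∀ u ∈ A, ∀ z ∈ B, ∀ v ∈ B,
      y ≠ x → u ≠ x → z ≠ x → v ≠ x → y ∈ M → z ∈ M → u ∈ N → v ∈ N → (M ∩ N).Nonempty

/-- `U` is closed under the lines: it contains every line that meets it in two points. -/
def IsLineClosed {P : Type*} (lines : Set (Set P)) (U : Set P) : Prop :=
  ∀ L ∈ lines, ∀ x ∈ L ∩ U, ∀ y ∈ L ∩ U, x ≠ y → L ⊆ U

/-- `U` is a member of the family `S`, and `d` is the largest length of a chain of members of `S`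
descending strictly from `U`. For the family of subspaces of a projective space this says that `U`
has projective dimension `d - 1`: the empty set has rank 0, a point rank 1, a line rank 2. -/
def HasRank {P : Type*} (S : Set (Set P)) (U : Set P) (d : ℕ) : Prop :=
  ∃ h : U ∈ S, Order.height (⟨U, h⟩ : S) = d

/-- A polar space of rank `n` with point set `P`, given by the axioms of Tits: a family of subsets
of `P`, called subspaces, such that
(P1) a subspace together with the subspaces it contains is a projective space of rank at most `n`;
(P2) the intersection of two subspaces is a subspace;
(P3) for a subspace `V` of rank `n` and a point `p` outside `V` there is a unique subspace `W`
through `p` that meets `V` in a subspace of rank `n - 1`, and `W` contains all the points of `V`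
that are on a line with `p`;
(P4) there are two disjoint subspaces of rank `n`. -/
structure PolarSpace (P : Type*) (n : ℕ) where
  subspaces : Set (Set P)
  isProjectiveSpace : ∀ V ∈ subspaces,
    IsProjectiveSpace V {L | HasRank subspaces L 2 ∧ L ⊆ V}
  mem_iff_isLineClosed : ∀ V ∈ subspaces, ∀ U, U ⊆ V →
    (U ∈ subspaces ↔ IsLineClosed {L | HasRank subspaces L 2 ∧ L ⊆ V} U)
  rank_le : ∀ V ∈ subspaces, ∃ d, d ≤ n ∧ HasRank subspaces V d
  inter_mem : ∀ V ∈ subspaces, ∀ W ∈ subspaces, V ∩ W ∈ subspaces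
  existsUnique_subspace : ∀ V, HasRank subspaces V n → ∀ p, p ∉ V →
    ∃! W, W ∈ subspaces ∧ p ∈ W ∧ ∃ m, m + 1 = n ∧ HasRank subspaces (V ∩ W) m
  mem_of_collinear : ∀ V, HasRank subspaces V n → ∀ p, p ∉ V →
    ∀ W, W ∈ subspaces → p ∈ W → (∃ m, m + 1 = n ∧ HasRank subspaces (V ∩ W) m) →
      ∀ x ∈ V, (∃ L, HasRank subspaces L 2 ∧ x ∈ L ∧ p ∈ L) → x ∈ W
  exists_disjoint : ∃ V W, HasRank subspaces V n ∧ HasRank subspaces W n ∧ Disjoint V W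

namespace PolarSpace

variable {P : Type*} {n : ℕ}

/-- A line of a polar space: a subspace of rank 2. -/
def IsLine (S : PolarSpace P n) (L : Set P) : Prop :=
  HasRank S.subspaces L 2

/-- A generator of a polar space of rank `n`: a subspace of rank `n`. -/
def IsGenerator (S : PolarSpace P n) (M : Set P) : Prop :=
  HasRank S.subspaces M n

/-- A polar space of rank `n` has order `(q, t)` if every line has exactly `q + 1` points and every
subspace of rank `n - 1` is contained in exactly `t + 1` generators. -/
def HasOrder (S : PolarSpace P n) (q t : ℕ) : Prop :=
  (∀ L, S.IsLine L → L.encard = q + 1) ∧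
  ∀ U m, m + 1 = n → HasRank S.subspaces U m → {M | S.IsGenerator M ∧ U ⊆ M}.encard = t + 1

/-- The polar graph (collinearity graph): two distinct points are adjacent if they are on a common
line. -/
def collinearityGraph (S : PolarSpace P n) : SimpleGraph P where
  Adj x y := x ≠ y ∧ ∃ L, S.IsLine L ∧ x ∈ L ∧ y ∈ L
  symm := ⟨fun _ _ ⟨h, L, hL, hx, hy⟩ => ⟨h.symm, L, hL, hy, hx⟩⟩
  loopless := ⟨fun _ h => h.1 rfl⟩

/-- An ovoid: a set of points that meets every generator in exactly one point. -/
def IsOvoid (S : PolarSpace P n) (O : Set P) : Prop :=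
  ∀ M, S.IsGenerator M → ∃! x, x ∈ O ∩ M

/-- The dual polar graph: the vertices are the generators, and two of them are adjacent if they
meet in a subspace of rank `n - 1`. -/
def dualPolarGraph (S : PolarSpace P n) : SimpleGraph {M : Set P // S.IsGenerator M} where
  Adj M N := M ≠ N ∧ ∃ m, m + 1 = n ∧ HasRank S.subspaces (M.1 ∩ N.1) m
  symm := ⟨fun _ _ ⟨h, m, hm, hr⟩ => ⟨h.symm, m, hm, by rw [Set.inter_comm]; exact hr⟩⟩
  loopless := ⟨fun _ h => h.1 rfl⟩

end PolarSpace

/-! ### Rank, joins and the modular law inside a subspace -/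

namespace PolarSpace

variable {P : Type*} {n : ℕ} (S : PolarSpace P n)

/-! (a) For `n ≥ 4`, Erdős–Ko–Rado for 2-sets, together with a star, gives clique number `n - 1`. A
coclique is a matching, so it has at most `n / 2` edges. The product reaches `n.choose 2` exactly
when there is a perfect matching.

(b) Every generator has the same number `f` of points, and every point is on the same number `g` of
generators (`HasOrder.ncard_generators_mem`, by projecting points onto generators). Hence `|P| g = f
G`, with `G` the number of generators. Cliques lie in generators, so `ω = f`. A coclique meets each
generator at most once, so `α g ≤ G`, and equality means that some coclique meets every generator,
that is, is an ovoid.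

(c) For `t = 1` the dual polar graph is triangle-free: two generators with a common neighbour meet
in a plane, and they then have exactly `q + 1` common neighbours. Let `f = pointCount q 5` be its
valency. It suffices that `ω ≤ f` and `α f < |C|`.

For the clique, fix a member `M`. The others meet `M` in planes that pairwise meet in at least a
line, since otherwise two of the planes span `M` and force too small an intersection. Such planes
lie in one solid or all contain one line, so there are at most `pointCount q 4` of them, and each
comes from at most `q` generators (`HasOrder.ncard_clique_le`).

For the coclique, neighbourhoods in the dual polar graph of distinct members are disjoint subsets of
a set as large as `C`, whence `α f ≤ |C|`. In case of equality they partition that set. The `f`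
neighbours of a vertex outside the coclique are then split into classes of size `q + 1`, which is
impossible because `f` is 1 modulo `q + 1` (`HasOrder.ncard_coclique_mul_lt`).

The bulk of the work is to derive projective geometry (rank, modular law, point and hyperplane
counts) from the axioms. -/

open Classical in
/-- The rank of a subspace, with value `0` on sets that are not subspaces. -/
noncomputable def rk (U : Set P) : ℕ :=
  if h : U ∈ S.subspaces then (Order.height (⟨U, h⟩ : S.subspaces)).toNat else 0

variable {S}

theorem height_eq_rk {U : Set P} (h : U ∈ S.subspaces) :
    Order.height (⟨U, h⟩ : S.subspaces) = S.rk U := by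
  obtain ⟨d, -, _, hd⟩ := S.rank_le U h
  simp [rk, h, hd]

theorem hasRank_iff {U : Set P} {d : ℕ} :
    HasRank S.subspaces U d ↔ U ∈ S.subspaces ∧ S.rk U = d := by
  constructor
  · rintro ⟨h, hd⟩
    rw [height_eq_rk] at hd
    exact ⟨h, by exact_mod_cast hd⟩
  · rintro ⟨h, rfl⟩
    exact ⟨h, height_eq_rk h⟩

theorem isLine_iff {L : Set P} : S.IsLine L ↔ L ∈ S.subspaces ∧ S.rk L = 2 := hasRank_iff

theorem isGenerator_iff {M : Set P} : S.IsGenerator M ↔ M ∈ S.subspaces ∧ S.rk M = n := hasRank_iff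

theorem IsLine.mem {L : Set P} (h : S.IsLine L) : L ∈ S.subspaces := (isLine_iff.1 h).1

theorem IsGenerator.mem {M : Set P} (h : S.IsGenerator M) : M ∈ S.subspaces :=
  (isGenerator_iff.1 h).1

theorem IsGenerator.rk_eq {M : Set P} (h : S.IsGenerator M) : S.rk M = n := (isGenerator_iff.1 h).2

theorem rk_le {U : Set P} (h : U ∈ S.subspaces) : S.rk U ≤ n := by
  obtain ⟨d, hd, hU⟩ := S.rank_le U h
  rw [(hasRank_iff.1 hU).2]
  exact hd

theorem rk_lt_rk {U V : Set P} (hU : U ∈ S.subspaces) (hV : V ∈ S.subspaces) (h : U ⊂ V) :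
    S.rk U < S.rk V := by
  have := Order.height_strictMono (x := (⟨U, hU⟩ : S.subspaces)) (y := ⟨V, hV⟩) h
    (by rw [height_eq_rk]; exact ENat.natCast_lt_top _)
  rw [height_eq_rk, height_eq_rk] at this
  exact_mod_cast this

theorem rk_mono {U V : Set P} (hU : U ∈ S.subspaces) (hV : V ∈ S.subspaces) (h : U ⊆ V) :
    S.rk U ≤ S.rk V := by
  rcases h.eq_or_ssubset with rfl | h
  · rfl
  · exact (rk_lt_rk hU hV h).le

theorem eq_of_subset_of_rk_le {U V : Set P} (hU : U ∈ S.subspaces) (hV : V ∈ S.subspaces)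
    (h : U ⊆ V) (hr : S.rk V ≤ S.rk U) : U = V := by
  by_contra hne
  exact absurd (rk_lt_rk hU hV (h.ssubset_of_ne hne)) (by omega)

theorem rk_le_of_forall_lt {U : Set P} (hU : U ∈ S.subspaces) {k : ℕ}
    (h : ∀ Z ∈ S.subspaces, Z ⊂ U → S.rk Z < k) : S.rk U ≤ k := by
  have : Order.height (⟨U, hU⟩ : S.subspaces) ≤ k := by
    rw [Order.height_le_coe_iff]
    rintro ⟨Z, hZ⟩ hlt
    rw [height_eq_rk]
    exact_mod_cast h Z hZ hlt
  rw [height_eq_rk] at this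
  exact_mod_cast this

variable (S) in
theorem empty_mem : ∅ ∈ S.subspaces := by
  obtain ⟨V, W, hV, hW, hd⟩ := S.exists_disjoint
  rw [← hd.inter_eq]
  exact S.inter_mem V (hasRank_iff.1 hV).1 W (hasRank_iff.1 hW).1

variable (S) in
theorem rk_empty : S.rk ∅ = 0 := by
  have := rk_le_of_forall_lt S.empty_mem (k := 0) (fun Z _ h => absurd (Set.empty_subset Z) h.2)
  omega

theorem nonempty_of_rk_pos {U : Set P} (h : 0 < S.rk U) : U.Nonempty := by
  rw [Set.nonempty_iff_ne_empty]
  rintro rfl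
  simp [rk_empty] at h

theorem singleton_mem {V : Set P} (hV : V ∈ S.subspaces) {x : P} (hx : x ∈ V) :
    {x} ∈ S.subspaces := by
  rw [S.mem_iff_isLineClosed V hV {x} (by simpa using hx)]
  rintro L - y ⟨-, rfl⟩ z ⟨-, rfl⟩ hne
  exact absurd rfl hne

theorem rk_pos {V : Set P} (hV : V ∈ S.subspaces) {x : P} (hx : x ∈ V) : 0 < S.rk V := by
  have := rk_lt_rk S.empty_mem hV (Set.empty_ssubset.2 ⟨x, hx⟩)
  omega

theorem two_le_rk {V : Set P} (hV : V ∈ S.subspaces) {x y : P} (hx : x ∈ V) (hy : y ∈ V)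
    (hne : x ≠ y) : 2 ≤ S.rk V := by
  have h1 := rk_pos (singleton_mem hV hx) (Set.mem_singleton x)
  have h2 := rk_lt_rk (singleton_mem hV hx) hV
    ((Set.ssubset_iff_of_subset (by simpa using hx)).2 ⟨y, hy, by simpa using hne.symm⟩)
  omega

theorem IsLine.subset {L V : Set P} (hL : S.IsLine L) (hV : V ∈ S.subspaces) {x y : P}
    (hxL : x ∈ L) (hyL : y ∈ L) (hxV : x ∈ V) (hyV : y ∈ V) (hne : x ≠ y) : L ⊆ V := by
  have hm := S.inter_mem L hL.mem V hV
  have h2 := two_le_rk hm ⟨hxL, hxV⟩ ⟨hyL, hyV⟩ hne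
  have := eq_of_subset_of_rk_le hm hL.mem Set.inter_subset_left (by rw [(isLine_iff.1 hL).2]; exact h2)
  exact Set.inter_eq_left.1 this

theorem IsLine.eq {L L' : Set P} (hL : S.IsLine L) (hL' : S.IsLine L') {x y : P}
    (hx : x ∈ L) (hy : y ∈ L) (hx' : x ∈ L') (hy' : y ∈ L') (hne : x ≠ y) : L = L' :=
  (hL.subset hL'.mem hx hy hx' hy' hne).antisymm (hL'.subset hL.mem hx' hy' hx hy hne)

theorem exists_isLine {V : Set P} (hV : V ∈ S.subspaces) {x y : P} (hx : x ∈ V) (hy : y ∈ V)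
    (hne : x ≠ y) : ∃ L, S.IsLine L ∧ L ⊆ V ∧ x ∈ L ∧ y ∈ L := by
  obtain ⟨L, ⟨⟨h1, h2⟩, h3, h4⟩, -⟩ := (S.isProjectiveSpace V hV).existsUnique_line x hx y hy hne
  exact ⟨L, h1, h2, h3, h4⟩

theorem mem_of_isLineClosed {V U : Set P} (hV : V ∈ S.subspaces) (hUV : U ⊆ V)
    (h : ∀ L, S.IsLine L → ∀ x ∈ L, ∀ y ∈ L, x ∈ U → y ∈ U → x ≠ y → L ⊆ U) :
    U ∈ S.subspaces := by
  rw [S.mem_iff_isLineClosed V hV U hUV]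
  rintro L ⟨hL, -⟩ x ⟨hx, hxU⟩ y ⟨hy, hyU⟩ hne
  exact h L hL x hx y hy hxU hyU hne

theorem IsLine.inter_nonempty {V A B M N : Set P} (hV : V ∈ S.subspaces)
    (hA : S.IsLine A) (hB : S.IsLine B) (hM : S.IsLine M) (hN : S.IsLine N)
    (hAV : A ⊆ V) (hBV : B ⊆ V) (hAB : A ≠ B) {x y u z v : P} (hxA : x ∈ A) (hxB : x ∈ B)
    (hy : y ∈ A) (hu : u ∈ A) (hz : z ∈ B) (hv : v ∈ B) (hyx : y ≠ x) (hux : u ≠ x)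
    (hzx : z ≠ x) (hvx : v ≠ x) (hyM : y ∈ M) (hzM : z ∈ M) (huN : u ∈ N) (hvN : v ∈ N) :
    (M ∩ N).Nonempty := by
  have hyz : y ≠ z := by
    rintro rfl
    exact hAB (hA.eq hB hxA hy hxB hz hyx.symm)
  have huv : u ≠ v := by
    rintro rfl
    exact hAB (hA.eq hB hxA hu hxB hv hux.symm)
  exact (S.isProjectiveSpace V hV).veblen A ⟨hA, hAV⟩ B ⟨hB, hBV⟩
    M ⟨hM, hM.subset hV hyM hzM (hAV hy) (hBV hz) hyz⟩
    N ⟨hN, hN.subset hV huN hvN (hAV hu) (hBV hv) huv⟩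
    hAB x ⟨hxA, hxB⟩ y hy u hu z hz v hv hyx hux hzx hvx hyM hzM huN hvN

variable (S) in
/-- The union of the lines joining the point `p` to the points of `U`. -/
def join (U : Set P) (p : P) : Set P :=
  {x | x = p ∨ x ∈ U ∨ ∃ u ∈ U, u ≠ p ∧ ∃ L, S.IsLine L ∧ u ∈ L ∧ p ∈ L ∧ x ∈ L}

theorem mem_join_self (U : Set P) (p : P) : p ∈ S.join U p := Or.inl rfl

theorem subset_join (U : Set P) (p : P) : U ⊆ S.join U p := fun _ h => Or.inr (Or.inl h)

theorem mem_join_of_line {U : Set P} {p u x : P} {L : Set P} (hL : S.IsLine L) (hu : u ∈ U)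
    (hup : u ≠ p) (huL : u ∈ L) (hpL : p ∈ L) (hxL : x ∈ L) : x ∈ S.join U p :=
  Or.inr (Or.inr ⟨u, hu, hup, L, hL, huL, hpL, hxL⟩)

theorem join_subset {U Z : Set P} {p : P} (hZ : Z ∈ S.subspaces) (hUZ : U ⊆ Z) (hp : p ∈ Z) :
    S.join U p ⊆ Z := by
  rintro x (rfl | hx | ⟨u, hu, hup, L, hL, huL, hpL, hxL⟩)
  · exact hp
  · exact hUZ hx
  · exact hL.subset hZ huL hpL (hUZ hu) hp hup hxL

/-- A line spanned by two points of `join U p` meets `U`. -/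
theorem exists_mem_line_of_mem_join {V U L : Set P} {p x y : P} (hV : V ∈ S.subspaces)
    (hU : U ∈ S.subspaces) (hUV : U ⊆ V) (hpV : p ∈ V) (hp : p ∉ U)
    (hx : x ∈ S.join U p) (hy : y ∈ S.join U p) (hne : x ≠ y) (hL : S.IsLine L)
    (hxL : x ∈ L) (hyL : y ∈ L) : ∃ w ∈ L, w ∈ U := by
  have key : ∀ y ∈ S.join U p, p ≠ y → ∀ L, S.IsLine L → p ∈ L → y ∈ L → ∃ w ∈ L, w ∈ U := by
    rintro y (rfl | hy | ⟨u, hu, hup, A, hA, huA, hpA, hyA⟩) hne L hL hpL hyL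
    · exact absurd rfl hne
    · exact ⟨y, hyL, hy⟩
    · rw [← hA.eq hL hpA hyA hpL hyL hne]
      exact ⟨u, huA, hu⟩
  by_cases hxp : x = p
  · subst hxp
    exact key y hy hne L hL hxL hyL
  by_cases hyp : y = p
  · subst hyp
    exact key x hx hne.symm L hL hyL hxL
  rcases hx with rfl | hx | ⟨u, hu, hup, A, hA, huA, hpA, hxA⟩
  · exact absurd rfl hxp
  · exact ⟨x, hxL, hx⟩
  rcases hy with rfl | hy | ⟨v, hv, hvp, B, hB, hvB, hpB, hyB⟩
  · exact absurd rfl hyp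
  · exact ⟨y, hyL, hy⟩
  by_cases hAB : A = B
  · subst hAB
    rw [← hA.eq hL hxA hyB hxL hyL hne]
    exact ⟨u, huA, hu⟩
  have huv : u ≠ v := by
    rintro rfl
    exact hAB (hA.eq hB huA hpA hvB hpB hup)
  obtain ⟨M, hM, hMU, huM, hvM⟩ := exists_isLine hU hu hv huv
  -- Veblen–Young with vertex `p`: the lines `uv` and `xy` both cross `A` and `B`.
  obtain ⟨w, hwM, hwL⟩ := IsLine.inter_nonempty hV hA hB hM hL
    (hA.subset hV huA hpA (hUV hu) hpV hup) (hB.subset hV hvB hpB (hUV hv) hpV hvp) hAB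
    hpA hpB huA hxA hvB hyB hup hxp hvp hyp huM hvM hxL hyL
  exact ⟨w, hwL, hMU hwM⟩

/-- A line through two points of the join meets `U`, so it suffices to treat lines with a point in
`U`; this is `key`, a second use of Veblen–Young. -/
theorem join_mem {V U : Set P} {p : P} (hV : V ∈ S.subspaces)
    (hU : U ∈ S.subspaces) (hUV : U ⊆ V) (hpV : p ∈ V) (hp : p ∉ U) :
    S.join U p ∈ S.subspaces := by
  have key : ∀ L, S.IsLine L → ∀ x ∈ L, ∀ y ∈ L, x ∈ U → y ∈ S.join U p → x ≠ y →
      L ⊆ S.join U p := by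
    intro L hL x hxL y hyL hx hy hne
    by_cases hyU : y ∈ U
    · exact (hL.subset hU hxL hyL hx hyU hne).trans (subset_join _ _)
    have hxp : x ≠ p := fun h => hp (h ▸ hx)
    by_cases hpL : p ∈ L
    · exact fun z hz => mem_join_of_line hL hx hxp hxL hpL hz
    rcases hy with rfl | hy | ⟨u, hu, hup, B, hB, huB, hpB, hyB⟩
    · exact absurd hyL hpL
    · exact absurd hy hyU
    intro z hz
    by_cases hzy : z = y
    · subst hzy
      exact mem_join_of_line hB hu hup huB hpB hyB
    have hyp : y ≠ p := fun h => hpL (h ▸ hyL)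
    have huy : u ≠ y := fun h => hyU (h ▸ hu)
    have hBV := hB.subset hV huB hpB (hUV hu) hpV hup
    have hLV := hL.subset hV hxL hyL (hUV hx) (hBV hyB) hne
    have hLB : L ≠ B := fun h => hpL (h ▸ hpB)
    have hxu : x ≠ u := by
      rintro rfl
      exact hLB (hL.eq hB hxL hyL huB hyB hne)
    have hzp : z ≠ p := fun h => hpL (h ▸ hz)
    obtain ⟨M, hM, hMU, hxM, huM⟩ := exists_isLine hU hx hu hxu
    obtain ⟨N, hN, -, hzN, hpN⟩ := exists_isLine hV (hLV hz) hpV hzp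
    obtain ⟨w, hwM, hwN⟩ := IsLine.inter_nonempty hV hL hB hM hN hLV hBV hLB hyL hyB
      hxL hz huB hpB hne hzy huy hyp.symm hxM huM hzN hpN
    exact mem_join_of_line hN (hMU hwM) (fun h => hp (h ▸ hMU hwM)) hwN hpN hzN
  refine mem_of_isLineClosed hV (join_subset hV hUV hpV) fun L hL x hxL y hyL hx hy hne => ?_
  obtain ⟨w, hwL, hw⟩ := exists_mem_line_of_mem_join hV hU hUV hpV hp hx hy hne hL hxL hyL
  by_cases hwx : w = x
  · subst hwx
    exact key L hL w hxL y hyL hw hy hne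
  · exact key L hL w hwL x hxL hw hx hwx

theorem ssubset_join {U : Set P} {p : P} (hp : p ∉ U) : U ⊂ S.join U p :=
  (Set.ssubset_iff_of_subset (subset_join _ _)).2 ⟨p, mem_join_self _ _, hp⟩

theorem join_eq_of_mem {V U : Set P} {p x : P} (hV : V ∈ S.subspaces)
    (hU : U ∈ S.subspaces) (hUV : U ⊆ V) (hpV : p ∈ V) (hp : p ∉ U) (hx : x ∈ S.join U p)
    (hxU : x ∉ U) : S.join U x = S.join U p := by
  have hxV : x ∈ V := join_subset hV hUV hpV hx
  refine (join_subset (join_mem hV hU hUV hpV hp) (subset_join _ _) hx).antisymm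
    (join_subset (join_mem hV hU hUV hxV hxU) (subset_join _ _) ?_)
  rcases hx with rfl | hx | ⟨u, hu, hup, B, hB, huB, hpB, hxB⟩
  · exact mem_join_self _ _
  · exact absurd hx hxU
  · exact mem_join_of_line hB hu (fun h => hxU (h ▸ hu)) huB hxB hpB

/-- A subspace contained in `join U p` but not in `U` is spanned by a point and its intersection
with `U`. -/
theorem eq_join_inter {V U Z : Set P} {p z : P} (hV : V ∈ S.subspaces)
    (hU : U ∈ S.subspaces) (hUV : U ⊆ V) (hpV : p ∈ V) (hp : p ∉ U) (hZ : Z ∈ S.subspaces)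
    (hZU : Z ⊆ S.join U p) (hz : z ∈ Z) (hzU : z ∉ U) : Z = S.join (Z ∩ U) z := by
  refine Set.Subset.antisymm (fun w hw => ?_) (join_subset hZ Set.inter_subset_left hz)
  by_cases hwz : w = z
  · subst hwz
    exact mem_join_self _ _
  obtain ⟨L, hL, hLZ, hwL, hzL⟩ := exists_isLine hZ hw hz hwz
  obtain ⟨y, hyL, hy⟩ := exists_mem_line_of_mem_join hV hU hUV hpV hp (hZU hw) (hZU hz) hwz hL
    hwL hzL
  exact mem_join_of_line hL ⟨hLZ hyL, hy⟩ (fun h => hzU (h ▸ hy)) hyL hzL hwL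

/-- A proper subspace `Z` of the join that is not inside `U` is the join of a point with `Z ∩ U`.
This is a proper subspace of `U`, for otherwise `Z` would be everything. By induction the rank of
`Z` is at most that of `U`. -/
theorem rk_join {V U : Set P} {p : P} (hV : V ∈ S.subspaces)
    (hU : U ∈ S.subspaces) (hUV : U ⊆ V) (hpV : p ∈ V) (hp : p ∉ U) :
    S.rk (S.join U p) = S.rk U + 1 := by
  induction hd : S.rk U using Nat.strong_induction_on generalizing U p with
  | _ d ih =>
  subst hd
  have hJ := join_mem hV hU hUV hpV hp
  refine le_antisymm (rk_le_of_forall_lt hJ fun Z hZ hZJ => ?_) (rk_lt_rk hU hJ (ssubset_join hp))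
  by_cases hZU : Z ⊆ U
  · have := rk_mono hZ hU hZU
    omega
  obtain ⟨z, hz, hzU⟩ := Set.not_subset.1 hZU
  have hI := S.inter_mem Z hZ U hU
  have hss : Z ∩ U ⊂ U := by
    refine Set.inter_subset_right.ssubset_of_ne fun h => hZJ.2 ?_
    rw [← join_eq_of_mem hV hU hUV hpV hp (hZJ.1 hz) hzU]
    exact join_subset hZ (Set.inter_eq_right.1 h) hz
  have hlt := rk_lt_rk hI hU hss
  have hZV : Z ⊆ V := hZJ.1.trans (join_subset hV hUV hpV)
  have := ih _ hlt hI (Set.inter_subset_right.trans hUV) (hZV hz) (fun h => hzU h.2) rfl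
  rw [← eq_join_inter hV hU hUV hpV hp hZ hZJ.1 hz hzU] at this
  omega

/-- The modular law: two subspaces `A`, `B` of a subspace `V` have a join `J`. -/
theorem exists_sup {V A B : Set P} (hV : V ∈ S.subspaces) (hA : A ∈ S.subspaces)
    (hB : B ∈ S.subspaces) (hAV : A ⊆ V) (hBV : B ⊆ V) :
    ∃ J ∈ S.subspaces, A ⊆ J ∧ B ⊆ J ∧ (∀ Z ∈ S.subspaces, A ⊆ Z → B ⊆ Z → J ⊆ Z) ∧
      S.rk J + S.rk (A ∩ B) = S.rk A + S.rk B := by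
  induction hd : S.rk B - S.rk (A ∩ B) using Nat.strong_induction_on generalizing A with
  | _ d ih =>
  by_cases hBA : B ⊆ A
  · refine ⟨A, hA, subset_rfl, hBA, fun Z _ h _ => h, ?_⟩
    rw [Set.inter_eq_right.2 hBA]
  obtain ⟨p, hpB, hpA⟩ := Set.not_subset.1 hBA
  have hpV := hBV hpB
  have hJ := join_mem hV hA hAV hpV hpA
  have hI := S.inter_mem A hA B hB
  have hIJ := S.inter_mem _ hJ B hB
  -- Adjoining `p ∈ B` to `A` raises the rank of `A` and of `A ∩ B` by one each, so the modular
  -- identity passes to the larger `A`.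
  have e : S.join A p ∩ B = S.join (A ∩ B) p := by
    have := eq_join_inter hV hA hAV hpV hpA hIJ Set.inter_subset_left ⟨mem_join_self _ _, hpB⟩ hpA
    rwa [Set.inter_right_comm, Set.inter_eq_right.2 (subset_join A p)] at this
  have r1 := rk_join hV hA hAV hpV hpA
  have r2 := rk_join hB hI Set.inter_subset_right hpB (fun h => hpA h.1)
  rw [← e] at r2
  have r3 := rk_mono hIJ hB Set.inter_subset_right
  obtain ⟨J, hJm, h1, h2, h3, h4⟩ := ih _ (by omega) hJ (join_subset hV hAV hpV) rfl
  refine ⟨J, hJm, (subset_join _ _).trans h1, h2, fun Z hZ hAZ hBZ => ?_, by omega⟩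
  exact h3 Z hZ (join_subset hZ hAZ (hBZ hpB)) hBZ

theorem rk_add_rk_le {V A B : Set P} (hV : V ∈ S.subspaces) (hA : A ∈ S.subspaces)
    (hB : B ∈ S.subspaces) (hAV : A ⊆ V) (hBV : B ⊆ V) :
    S.rk A + S.rk B ≤ S.rk V + S.rk (A ∩ B) := by
  obtain ⟨J, hJ, -, -, h, hr⟩ := exists_sup hV hA hB hAV hBV
  have := rk_mono hJ hV (h V hV hAV hBV)
  omega

variable (S) in
/-- The hyperplanes of a subspace `V`. -/
def hyperplanes (V : Set P) : Set (Set P) :=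
  {H | H ∈ S.subspaces ∧ H ⊆ V ∧ S.rk H + 1 = S.rk V}

theorem join_eq_of_mem_hyperplanes {V H : Set P} {p : P} (hV : V ∈ S.subspaces)
    (hH : H ∈ S.hyperplanes V) (hp : p ∈ V) (hpH : p ∉ H) : S.join H p = V := by
  have := rk_join hV hH.1 hH.2.1 hp hpH
  exact eq_of_subset_of_rk_le (join_mem hV hH.1 hH.2.1 hp hpH) hV (join_subset hV hH.2.1 hp)
    (by have := hH.2.2; omega)

theorem exists_notMem_of_rk_lt {V H : Set P} (hV : V ∈ S.subspaces) (hH : H ∈ S.subspaces)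
    (hr : S.rk H < S.rk V) : ∃ x ∈ V, x ∉ H := by
  by_contra! h
  have := rk_mono hV hH h
  omega

theorem rk_inter_hyperplanes {V H K : Set P} (hV : V ∈ S.subspaces) (hH : H ∈ S.hyperplanes V)
    (hK : K ∈ S.hyperplanes V) (hne : H ≠ K) : S.rk (H ∩ K) + 2 = S.rk V := by
  have h1 := rk_add_rk_le hV hH.1 hK.1 hH.2.1 hK.2.1
  have h2 : S.rk (H ∩ K) < S.rk H := by
    refine rk_lt_rk (S.inter_mem _ hH.1 _ hK.1) hH.1 (Set.inter_subset_left.ssubset_of_ne ?_)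
    intro h
    exact hne (eq_of_subset_of_rk_le hH.1 hK.1 (Set.inter_eq_left.1 h)
      (by have := hH.2.2; have := hK.2.2; omega))
  have := hH.2.2
  have := hK.2.2
  omega

section Finite

variable [Finite P]

/-- A maximal subspace avoiding `p` works: adding any further point captures `p`, so by exchange
that point lies in the join with `p`. -/
theorem exists_hyperplane_notMem {V : Set P} (hV : V ∈ S.subspaces) {p : P} (hp : p ∈ V) :
    ∃ H ∈ S.hyperplanes V, p ∉ H := by
  obtain ⟨H, -, hmax⟩ := Set.Finite.exists_le_maximal
    (s := {H | H ∈ S.subspaces ∧ H ⊆ V ∧ p ∉ H}) (Set.toFinite _)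
    ⟨S.empty_mem, Set.empty_subset V, Set.notMem_empty p⟩
  obtain ⟨⟨hH, hHV, hpH⟩, hmax⟩ := hmax
  refine ⟨H, ⟨hH, hHV, ?_⟩, hpH⟩
  rw [← rk_join hV hH hHV hp hpH]
  congr 1
  refine (join_subset hV hHV hp).antisymm fun x hx => ?_
  by_cases hxH : x ∈ H
  · exact subset_join _ _ hxH
  have hxJ := join_mem hV hH hHV hx hxH
  have hpx : p ∈ S.join H x := by
    by_contra hpx
    exact (ssubset_join hxH).2
      (hmax ⟨hxJ, join_subset hV hHV hx, hpx⟩ (subset_join _ _))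
  rw [join_eq_of_mem hV hH hHV hx hxH hpx hpH]
  exact mem_join_self _ _

end Finite

end PolarSpace

/-! ### Double counting with `Set.ncard` -/

namespace Set

theorem ncard_eq_one_of_existsUnique {α : Type*} {s : Set α} (h : ∃! x, x ∈ s) : s.ncard = 1 := by
  obtain ⟨x, hx, hu⟩ := h
  exact ncard_eq_one.2 ⟨x, Set.ext fun y => ⟨fun hy => hu y hy, fun hy => hy ▸ hx⟩⟩

variable {α β : Type*} [Finite α] [Finite β]

theorem ncard_mul_eq_ncard_mul (r : α → β → Prop) {s : Set α} {t : Set β} {k l : ℕ}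
    (hk : ∀ a ∈ s, {b ∈ t | r a b}.ncard = k) (hl : ∀ b ∈ t, {a ∈ s | r a b}.ncard = l) :
    s.ncard * k = t.ncard * l := by
  classical
  have hs := s.toFinite
  have ht := t.toFinite
  rw [ncard_eq_toFinset_card s hs, ncard_eq_toFinset_card t ht]
  refine Finset.card_mul_eq_card_mul r (fun a ha => ?_) (fun b hb => ?_)
  · rw [← hk a (by simpa using ha), ← ncard_coe_finset]
    congr 1
    ext b
    simp
  · rw [← hl b (by simpa using hb), ← ncard_coe_finset]
    congr 1
    ext b
    simp

theorem ncard_mul_le_ncard_mul (r : α → β → Prop) {s : Set α} {t : Set β} {k l : ℕ}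
    (hk : ∀ a ∈ s, k ≤ {b ∈ t | r a b}.ncard) (hl : ∀ b ∈ t, {a ∈ s | r a b}.ncard ≤ l) :
    s.ncard * k ≤ t.ncard * l := by
  classical
  have hs := s.toFinite
  have ht := t.toFinite
  rw [ncard_eq_toFinset_card s hs, ncard_eq_toFinset_card t ht]
  refine Finset.card_mul_le_card_mul r (fun a ha => ?_) (fun b hb => ?_)
  · refine (hk a (by simpa using ha)).trans_eq ?_
    rw [← ncard_coe_finset]
    congr 1
    ext b
    simp
  · refine Eq.trans_le ?_ (hl b (by simpa using hb))
    rw [← ncard_coe_finset]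
    congr 1
    ext b
    simp

/-- If every element of `s` is related to a unique element of `t`, and two sets are related in this
way to `t` with equally many related elements over each element of `t`, they are equinumerous. -/
theorem ncard_eq_ncard_of_fibers (r : α → β → Prop) {s s' : Set α} {t : Set β}
    (h : ∀ a ∈ s, ∃! b, b ∈ t ∧ r a b) (h' : ∀ a ∈ s', ∃! b, b ∈ t ∧ r a b)
    (hf : ∀ b ∈ t, {a ∈ s | r a b}.ncard = {a ∈ s' | r a b}.ncard) : s.ncard = s'.ncard := by
  classical
  have key : ∀ s : Set α, (∀ a ∈ s, ∃! b, b ∈ t ∧ r a b) →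
      s.ncard = ∑ b ∈ t.toFinite.toFinset, {a ∈ s | r a b}.ncard := by
    intro s h
    have := Finset.sum_card_bipartiteAbove_eq_sum_card_bipartiteBelow
      (s := s.toFinite.toFinset) (t := t.toFinite.toFinset) r
    rw [ncard_eq_toFinset_card s, Finset.card_eq_sum_ones]
    convert this using 2 with a ha b hb
    · rw [← ncard_coe_finset, eq_comm]
      refine ncard_eq_one_of_existsUnique ?_
      simpa using h a (by simpa using ha)
    · rw [← ncard_coe_finset]
      congr 1
      ext b
      simp
  rw [key s h, key s' h']
  exact Finset.sum_congr rfl fun b hb => hf b (by simpa using hb)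

end Set

/-! ### Collinearity, generators and projections -/

namespace PolarSpace

variable {P : Type*} {n : ℕ} {S : PolarSpace P n}

/-- Two points are collinear if they are equal or on a common line. -/
def Collinear (S : PolarSpace P n) (x y : P) : Prop :=
  x = y ∨ ∃ L, S.IsLine L ∧ x ∈ L ∧ y ∈ L

theorem Collinear.symm {x y : P} (h : S.Collinear x y) : S.Collinear y x := by
  rcases h with rfl | ⟨L, hL, hx, hy⟩
  · exact Or.inl rfl
  · exact Or.inr ⟨L, hL, hy, hx⟩

theorem collinear_of_mem {V : Set P} (hV : V ∈ S.subspaces) {x y : P} (hx : x ∈ V) (hy : y ∈ V) :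
    S.Collinear x y := by
  by_cases h : x = y
  · exact Or.inl h
  · obtain ⟨L, hL, -, hxL, hyL⟩ := exists_isLine hV hx hy h
    exact Or.inr ⟨L, hL, hxL, hyL⟩

theorem collinearityGraph_adj {x y : P} :
    S.collinearityGraph.Adj x y ↔ x ≠ y ∧ S.Collinear x y := by
  simp only [collinearityGraph, Collinear]
  tauto

theorem isGenerator_of_ssubset {H W : Set P} (hW : W ∈ S.subspaces) (hH : H ∈ S.subspaces)
    (hr : S.rk H + 1 = n) (hHW : H ⊂ W) : S.IsGenerator W := by
  have := rk_lt_rk hH hW hHW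
  have := rk_le hW
  exact isGenerator_iff.2 ⟨hW, by omega⟩

/-- Two generators are adjacent if they meet in a common hyperplane. -/
def GenAdj (S : PolarSpace P n) (M N : Set P) : Prop :=
  S.IsGenerator M ∧ S.IsGenerator N ∧ S.rk (M ∩ N) + 1 = n

theorem GenAdj.symm {M N : Set P} (h : S.GenAdj M N) : S.GenAdj N M :=
  ⟨h.2.1, h.1, by rw [Set.inter_comm]; exact h.2.2⟩

theorem GenAdj.inter_mem {M N : Set P} (h : S.GenAdj M N) : M ∩ N ∈ S.hyperplanes M :=
  ⟨S.inter_mem _ h.1.mem _ h.2.1.mem, Set.inter_subset_left, by rw [h.1.rk_eq]; exact h.2.2⟩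

theorem GenAdj.ne {M N : Set P} (h : S.GenAdj M N) : M ≠ N := by
  rintro rfl
  have h2 := h.2.2
  rw [Set.inter_self, h.1.rk_eq] at h2
  omega

theorem dualPolarGraph_adj {M N : {M : Set P // S.IsGenerator M}} :
    S.dualPolarGraph.Adj M N ↔ S.GenAdj M N := by
  constructor
  · rintro ⟨-, m, hm, hr⟩
    exact ⟨M.2, N.2, by rw [(hasRank_iff.1 hr).2]; exact hm⟩
  · intro h
    exact ⟨fun e => h.ne (congrArg _ e), _, h.2.2, hasRank_iff.2 ⟨h.inter_mem.1, rfl⟩⟩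

theorem IsGenerator.eq_of_subset {M N : Set P} (hM : S.IsGenerator M) (hN : S.IsGenerator N)
    (h : M ⊆ N) : M = N :=
  eq_of_subset_of_rk_le hM.mem hN.mem h (by rw [hM.rk_eq, hN.rk_eq])

theorem genAdj_of_hyperplane {M N H : Set P} (hM : S.IsGenerator M) (hN : S.IsGenerator N)
    (hne : M ≠ N) (hH : H ∈ S.hyperplanes M) (hHN : H ⊆ N) : S.GenAdj M N ∧ M ∩ N = H := by
  have hI := S.inter_mem _ hM.mem _ hN.mem
  have h1 := rk_mono hH.1 hI (Set.subset_inter hH.2.1 hHN)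
  have h2 := rk_lt_rk hI hM.mem (Set.inter_subset_left.ssubset_of_ne
    fun h => hne (hM.eq_of_subset hN (Set.inter_eq_left.1 h)))
  have h3 := hH.2.2
  have h4 := hM.rk_eq
  exact ⟨⟨hM, hN, by omega⟩,
    (eq_of_subset_of_rk_le hH.1 hI (Set.subset_inter hH.2.1 hHN) (by omega)).symm⟩

/-- The projection of a point onto a generator. -/
theorem exists_proj {M : Set P} (hM : S.IsGenerator M) {p : P} (hp : p ∉ M) :
    ∃ W, S.GenAdj M W ∧ p ∈ W ∧ ∀ x ∈ M, S.Collinear x p ↔ x ∈ W := by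
  obtain ⟨W, ⟨hW, hpW, m, hm, hr⟩, -⟩ := S.existsUnique_subspace M hM p hp
  have hr' := hasRank_iff.1 hr
  have hWg : S.IsGenerator W := isGenerator_of_ssubset hW hr'.1 (by omega)
    ((Set.ssubset_iff_of_subset Set.inter_subset_right).2 ⟨p, hpW, fun h => hp h.1⟩)
  refine ⟨W, ⟨hM, hWg, by omega⟩, hpW, fun x hx => ⟨?_, fun hxW => collinear_of_mem hW hxW hpW⟩⟩
  rintro (rfl | h)
  · exact hpW
  · exact S.mem_of_collinear M hM p hp W hW hpW ⟨m, hm, hr⟩ x hx h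

theorem GenAdj.eq {M W W' : Set P} {p : P} (hW : S.GenAdj M W) (hW' : S.GenAdj M W')
    (hp : p ∈ W) (hp' : p ∈ W') (hpM : p ∉ M) : W = W' := by
  have key : ∀ W, S.GenAdj M W → ∃ m, m + 1 = n ∧ HasRank S.subspaces (M ∩ W) m :=
    fun W h => ⟨_, h.2.2, hasRank_iff.2 ⟨h.inter_mem.1, rfl⟩⟩
  exact (S.existsUnique_subspace M hW.1 p hpM).unique ⟨hW.2.1.mem, hp, key W hW⟩
    ⟨hW'.2.1.mem, hp', key W' hW'⟩

theorem existsUnique_genAdj {M : Set P} (hM : S.IsGenerator M) {p : P} (hp : p ∉ M) :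
    ∃! W, p ∈ W ∧ S.GenAdj M W := by
  obtain ⟨W, hW, hpW, -⟩ := exists_proj hM hp
  exact ⟨W, ⟨hpW, hW⟩, fun W' hW' => hW'.2.eq hW hW'.1 hpW hp⟩

/-- A point collinear with all points of two subspaces that span a generator belongs to the
generator. -/
theorem mem_of_forall_collinear_sup {M A B : Set P} (hM : S.IsGenerator M) (hA : A ∈ S.subspaces)
    (hB : B ∈ S.subspaces) (hAM : A ⊆ M) (hBM : B ⊆ M) {p : P}
    (hr : n + S.rk (A ∩ B) ≤ S.rk A + S.rk B)
    (hpA : ∀ x ∈ A, S.Collinear x p) (hpB : ∀ x ∈ B, S.Collinear x p) : p ∈ M := by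
  by_contra hp
  obtain ⟨W, hW, hpW, hx⟩ := exists_proj hM hp
  -- The points of `M` collinear with `p` form the hyperplane `M ∩ W`, which is too small to contain
  -- both `A` and `B`.
  have h1 := rk_add_rk_le hW.inter_mem.1 hA hB
    (fun x hxA => ⟨hAM hxA, (hx x (hAM hxA)).1 (hpA x hxA)⟩)
    (fun x hxB => ⟨hBM hxB, (hx x (hBM hxB)).1 (hpB x hxB)⟩)
  have := hW.2.2
  omega

/-- Pairwise collinear points are contained in a common generator. -/
theorem exists_isGenerator_superset [Finite P] {K : Set P}
    (hK : ∀ x ∈ K, ∀ y ∈ K, S.Collinear x y) : ∃ M, S.IsGenerator M ∧ K ⊆ M := by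
  obtain ⟨V, -, hV, -, -⟩ := S.exists_disjoint
  -- Projecting a missed point `p` of `K` yields a generator that keeps `K ∩ M` and gains `p`,
  -- against maximality.
  obtain ⟨M, hM, hmax⟩ := Set.Finite.exists_maximalFor (fun M => K ∩ M) {M | S.IsGenerator M}
    (Set.toFinite _) ⟨V, hV⟩
  refine ⟨M, hM, fun p hp => ?_⟩
  by_contra hpM
  obtain ⟨W, hW, hpW, hx⟩ := exists_proj hM hpM
  have hsub : K ∩ M ⊆ K ∩ W := fun x hx' => ⟨hx'.1, (hx x hx'.2).1 (hK x hx'.1 p hp)⟩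
  exact hpM (hmax hW.2.1 hsub ⟨hp, hpW⟩).2

/-! ### Counting in a subspace -/

/-- The number of points of a projective space of rank `d` whose lines have `q + 1` points. -/
def pointCount (q : ℕ) : ℕ → ℕ
  | 0 => 0
  | d + 1 => 1 + q * pointCount q d

variable [Finite P] {q t : ℕ}

theorem HasOrder.ncard_line (h : S.HasOrder q t) {L : Set P} (hL : S.IsLine L) :
    L.ncard = q + 1 := by
  have := h.1 L hL
  rw [← Set.coe_ncard_eq_encard] at this
  exact_mod_cast this

theorem HasOrder.ncard_generators (h : S.HasOrder q t) {U : Set P} (hU : U ∈ S.subspaces)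
    (hr : S.rk U + 1 = n) : {M | S.IsGenerator M ∧ U ⊆ M}.ncard = t + 1 := by
  have := h.2 U _ hr (hasRank_iff.2 ⟨hU, rfl⟩)
  rw [← Set.coe_ncard_eq_encard] at this
  exact_mod_cast this

theorem HasOrder.ncard_genAdj (h : S.HasOrder q t) {M H : Set P} (hM : S.IsGenerator M)
    (hH : H ∈ S.hyperplanes M) : {N | S.GenAdj M N ∧ M ∩ N = H}.ncard = t := by
  have h1 := h.ncard_generators hH.1 (hH.2.2.trans hM.rk_eq)
  have h2 : {N | S.GenAdj M N ∧ M ∩ N = H} = {N | S.IsGenerator N ∧ H ⊆ N} \ {M} := by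
    ext N
    constructor
    · rintro ⟨hN, rfl⟩
      exact ⟨⟨hN.2.1, Set.inter_subset_right⟩, hN.ne.symm⟩
    · rintro ⟨⟨hN, hHN⟩, hne⟩
      exact genAdj_of_hyperplane hM hN (Ne.symm hne) hH hHN
  have hM' : M ∈ {N | S.IsGenerator N ∧ H ⊆ N} := ⟨hM, hH.2.1⟩
  rw [h2, Set.ncard_sdiff_singleton_of_mem hM', h1]
  omega

/-- Project from `p` onto a hyperplane missing `p`: each line on `p` meets it once and has `q`
points other than `p`. -/
theorem HasOrder.ncard_eq (h : S.HasOrder q t) {V : Set P} (hV : V ∈ S.subspaces) :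
    V.ncard = pointCount q (S.rk V) := by
  induction hd : S.rk V generalizing V with
  | zero =>
    rcases V.eq_empty_or_nonempty with rfl | ⟨x, hx⟩
    · simp [pointCount]
    · have := rk_pos hV hx
      omega
  | succ d ih =>
    obtain ⟨p, hp⟩ := nonempty_of_rk_pos (S := S) (U := V) (by omega)
    obtain ⟨H, hH, hpH⟩ := exists_hyperplane_notMem hV hp
    have hHd : S.rk H = d := by have := hH.2.2; omega
    have hJ := join_eq_of_mem_hyperplanes hV hH hp hpH
    have key := Set.ncard_mul_eq_ncard_mul
      (fun (x y : P) => ∃ L, S.IsLine L ∧ x ∈ L ∧ y ∈ L ∧ p ∈ L)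
      (s := V \ {p}) (t := H) (k := 1) (l := q) ?_ ?_
    · rw [Set.ncard_sdiff_singleton_of_mem hp, ih hH.1 hHd] at key
      have := (Set.ncard_pos V.toFinite).2 ⟨p, hp⟩
      rw [pointCount, mul_comm q]
      omega
    · rintro x ⟨hxV, hxp⟩
      refine Set.ncard_eq_one_of_existsUnique ?_
      obtain ⟨L, hL, hLV, hxL, hpL⟩ := exists_isLine hV hxV hp hxp
      obtain ⟨y, hyL, hy⟩ := exists_mem_line_of_mem_join hV hH.1 hH.2.1 hp hpH
        (hJ ▸ hxV) (mem_join_self _ _) hxp hL hxL hpL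
      refine ⟨y, ⟨hy, L, hL, hxL, hyL, hpL⟩, ?_⟩
      rintro z ⟨hz, L', hL', hxL', hzL', hpL'⟩
      obtain rfl := hL.eq hL' hxL hpL hxL' hpL' hxp
      by_contra hne
      exact hpH (hL.subset hH.1 hzL' hyL hz hy hne hpL)
    · intro y hy
      have hyp : y ≠ p := fun e => hpH (e ▸ hy)
      obtain ⟨L, hL, hLV, hyL, hpL⟩ := exists_isLine hV (hH.2.1 hy) hp hyp
      have : {x | x ∈ V \ {p} ∧ ∃ L, S.IsLine L ∧ x ∈ L ∧ y ∈ L ∧ p ∈ L} = L \ {p} := by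
        ext x
        constructor
        · rintro ⟨⟨-, hxp⟩, L', hL', hxL', hyL', hpL'⟩
          rw [hL.eq hL' hyL hpL hyL' hpL' hyp]
          exact ⟨hxL', hxp⟩
        · rintro ⟨hxL, hxp⟩
          exact ⟨⟨hLV hxL, hxp⟩, L, hL, hxL, hyL, hpL⟩
      rw [this, Set.ncard_sdiff_singleton_of_mem hpL, h.ncard_line hL]
      omega

/-- A subspace of corank two is contained in `q + 1` hyperplanes. -/
theorem HasOrder.ncard_hyperplanes_superset (h : S.HasOrder q t) {V C : Set P}
    (hV : V ∈ S.subspaces) (hC : C ∈ S.subspaces) (hCV : C ⊆ V) (hr : S.rk C + 2 = S.rk V) :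
    {H ∈ S.hyperplanes V | C ⊆ H}.ncard = q + 1 := by
  obtain ⟨x, hxV, hxC⟩ := exists_notMem_of_rk_lt hV hC (by omega)
  have hr1 := rk_join hV hC hCV hxV hxC
  obtain ⟨y, hyV, hyC⟩ := exists_notMem_of_rk_lt hV (join_mem hV hC hCV hxV hxC) (by omega)
  have hxy : x ≠ y := fun e => hyC (e ▸ mem_join_self _ _)
  obtain ⟨L, hL, hLV, hxL, hyL⟩ := exists_isLine hV hxV hyV hxy
  -- `L` is a complement of `C` in `V`; the hyperplanes on `C` correspond to the points of `L`.
  have hLC : ∀ s ∈ L, s ∉ C := fun s hs hsC =>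
    hyC (mem_join_of_line hL hsC (fun e => hxC (e ▸ hsC)) hs hxL hyL)
  rw [← h.ncard_line hL]
  have himg : {H ∈ S.hyperplanes V | C ⊆ H} = S.join C '' L := by
    ext H
    constructor
    · rintro ⟨hH, hCH⟩
      have h1 := rk_add_rk_le hV hL.mem hH.1 hLV hH.2.1
      have h2 := (isLine_iff.1 hL).2
      have h3 := hH.2.2
      obtain ⟨s, hsL, hsH⟩ := nonempty_of_rk_pos (S := S) (U := L ∩ H) (by omega)
      have h4 := rk_join hV hC hCV (hLV hsL) (hLC s hsL)
      exact ⟨s, hsL, eq_of_subset_of_rk_le (join_mem hV hC hCV (hLV hsL) (hLC s hsL)) hH.1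
        (join_subset hH.1 hCH hsH) (by omega)⟩
    · rintro ⟨s, hsL, rfl⟩
      have h4 := rk_join hV hC hCV (hLV hsL) (hLC s hsL)
      exact ⟨⟨join_mem hV hC hCV (hLV hsL) (hLC s hsL), join_subset hV hCV (hLV hsL), by omega⟩,
        subset_join _ _⟩
  rw [himg]
  refine Set.InjOn.ncard_image fun s hs s' hs' e => ?_
  by_contra hne
  obtain ⟨w, hwL, hwC⟩ := exists_mem_line_of_mem_join hV hC hCV (hLV hs) (hLC s hs)
    (mem_join_self _ _) (by rw [e]; exact mem_join_self _ _) hne hL hs hs'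
  exact hLC w hwL hwC

/-- Fix a hyperplane `K`. Every other one cuts `K` in a hyperplane of `K`, and each of these arises
`q` times. -/
theorem HasOrder.ncard_hyperplanes (h : S.HasOrder q t) {V : Set P} (hV : V ∈ S.subspaces) :
    (S.hyperplanes V).ncard = pointCount q (S.rk V) := by
  induction hd : S.rk V generalizing V with
  | zero =>
    rw [pointCount, Set.ncard_eq_zero]
    ext H
    simp [hyperplanes, hd]
  | succ d ih =>
    obtain ⟨p, hp⟩ := nonempty_of_rk_pos (S := S) (U := V) (by omega)
    obtain ⟨K, hK, -⟩ := exists_hyperplane_notMem hV hp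
    have hKd : S.rk K = d := by have := hK.2.2; omega
    have key := Set.ncard_mul_eq_ncard_mul (fun H C : Set P => H ∩ K = C)
      (s := S.hyperplanes V \ {K}) (t := S.hyperplanes K) (k := 1) (l := q) ?_ ?_
    · rw [Set.ncard_sdiff_singleton_of_mem hK, ih hK.1 hKd] at key
      have := (Set.ncard_pos (S.hyperplanes V).toFinite).2 ⟨K, hK⟩
      rw [pointCount, mul_comm q]
      omega
    · rintro H ⟨hH, hne⟩
      refine Set.ncard_eq_one_of_existsUnique ⟨H ∩ K, ⟨⟨S.inter_mem _ hH.1 _ hK.1,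
        Set.inter_subset_right, ?_⟩, rfl⟩, fun C hC => hC.2.symm⟩
      have := rk_inter_hyperplanes hV hH hK hne
      omega
    · intro C hC
      have hCr := hC.2.2
      have : {H | H ∈ S.hyperplanes V \ {K} ∧ H ∩ K = C} =
          {H ∈ S.hyperplanes V | C ⊆ H} \ {K} := by
        ext H
        constructor
        · rintro ⟨⟨h1, h2⟩, rfl⟩
          exact ⟨⟨h1, Set.inter_subset_left⟩, h2⟩
        · rintro ⟨⟨h1, h2⟩, h3⟩
          have := rk_inter_hyperplanes hV h1 hK h3
          exact ⟨⟨h1, h3⟩, (eq_of_subset_of_rk_le hC.1 (S.inter_mem _ h1.1 _ hK.1)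
            (Set.subset_inter h2 hC.2.1) (by omega)).symm⟩
      have hK' : K ∈ {H ∈ S.hyperplanes V | C ⊆ H} := ⟨hK, hC.2.1⟩
      rw [this, Set.ncard_sdiff_singleton_of_mem hK',
        h.ncard_hyperplanes_superset hV hC.1 (hC.2.1.trans hK.2.1) (by omega)]
      omega

/-- With `K` a hyperplane missing `p`, joining with `p` and intersecting with `K` are inverse to
each other. -/
theorem HasOrder.ncard_hyperplanes_mem (h : S.HasOrder q t) {V : Set P} (hV : V ∈ S.subspaces)
    {p : P} (hp : p ∈ V) :
    {H ∈ S.hyperplanes V | p ∈ H}.ncard = pointCount q (S.rk V - 1) := by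
  obtain ⟨K, hK, hpK⟩ := exists_hyperplane_notMem hV hp
  have hKr := hK.2.2
  rw [← hKr, Nat.add_sub_cancel, ← h.ncard_hyperplanes hK.1]
  have hCp : ∀ C ∈ S.hyperplanes K, p ∉ C := fun C hC hpC => hpK (hC.2.1 hpC)
  have himg : {H ∈ S.hyperplanes V | p ∈ H} = (fun C => S.join C p) '' S.hyperplanes K := by
    ext H
    constructor
    · rintro ⟨hH, hpH⟩
      have hI := S.inter_mem _ hH.1 _ hK.1
      have h1 := rk_inter_hyperplanes hV hH hK (fun e => hpK (e ▸ hpH))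
      refine ⟨H ∩ K, ⟨hI, Set.inter_subset_right, by omega⟩, ?_⟩
      have h2 := rk_join hH.1 hI Set.inter_subset_left hpH (fun e => hpK e.2)
      have := hH.2.2
      exact eq_of_subset_of_rk_le (join_mem hH.1 hI Set.inter_subset_left hpH (fun e => hpK e.2))
        hH.1 (join_subset hH.1 Set.inter_subset_left hpH) (by beta_reduce; omega)
    · rintro ⟨C, hC, rfl⟩
      have h2 := rk_join hV hC.1 (hC.2.1.trans hK.2.1) hp (hCp C hC)
      have := hC.2.2
      exact ⟨⟨join_mem hV hC.1 (hC.2.1.trans hK.2.1) hp (hCp C hC),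
        join_subset hV (hC.2.1.trans hK.2.1) hp, by beta_reduce; omega⟩, mem_join_self _ _⟩
  rw [himg]
  refine Set.InjOn.ncard_image fun C hC C' hC' e => ?_
  have key : ∀ C ∈ S.hyperplanes K, S.join C p ∩ K = C := by
    intro C hC
    have h1 := join_mem hV hC.1 (hC.2.1.trans hK.2.1) hp (hCp C hC)
    have h2 := rk_join hV hC.1 (hC.2.1.trans hK.2.1) hp (hCp C hC)
    have h3 := rk_lt_rk (S.inter_mem _ h1 _ hK.1) h1 ((Set.ssubset_iff_of_subset
      Set.inter_subset_left).2 ⟨p, mem_join_self _ _, fun e => hpK e.2⟩)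
    exact (eq_of_subset_of_rk_le hC.1 (S.inter_mem _ h1 _ hK.1)
      (Set.subset_inter (subset_join _ _) hC.2.1) (by omega)).symm
  rw [← key C hC, e, key C' hC']

end PolarSpace

/-! ### Generators through a point, and ovoids (b) -/

namespace PolarSpace

variable {P : Type*} {n : ℕ} {S : PolarSpace P n} [Finite P] {q t : ℕ}

theorem HasOrder.ncard_hyperplanes_mem_notMem (h : S.HasOrder q t) {V : Set P}
    (hV : V ∈ S.subspaces) {x y : P} (hx : x ∈ V) (hy : y ∈ V) :
    {H ∈ S.hyperplanes V | x ∈ H ∧ y ∉ H}.ncard =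
      {H ∈ S.hyperplanes V | y ∈ H ∧ x ∉ H}.ncard := by
  have key : ∀ x y, {H ∈ S.hyperplanes V | x ∈ H ∧ y ∉ H} =
      {H ∈ S.hyperplanes V | x ∈ H} \ {H ∈ S.hyperplanes V | y ∈ H} := by
    intro x y
    ext H
    simp only [Set.mem_ofPred_eq, Set.mem_sdiff]
    tauto
  rw [key, key, ← Set.ncard_eq_ncard_iff_ncard_sdiff_eq_ncard_sdiff,
    h.ncard_hyperplanes_mem hV hx, h.ncard_hyperplanes_mem hV hy]

theorem HasOrder.ncard_genAdj_mem_notMem (h : S.HasOrder q t) {W : Set P}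
    (hW : S.IsGenerator W) {x y : P} (hx : x ∈ W) (hy : y ∈ W) :
    {M | (x ∈ M ∧ y ∉ M) ∧ S.GenAdj W M}.ncard =
      {H ∈ S.hyperplanes W | x ∈ H ∧ y ∉ H}.ncard * t := by
  rw [← mul_one (Set.ncard _)]
  refine Set.ncard_mul_eq_ncard_mul (fun M H => W ∩ M = H) (fun M hM => ?_) (fun H hH => ?_)
  · refine Set.ncard_eq_one_of_existsUnique ⟨W ∩ M, ⟨⟨hM.2.inter_mem, ⟨hx, hM.1.1⟩,
      fun e => hM.1.2 e.2⟩, rfl⟩, fun H hH => hH.2.symm⟩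
  · rw [← h.ncard_genAdj hW hH.1]
    congr 1
    ext M
    constructor
    · rintro ⟨⟨-, h1⟩, h2⟩
      exact ⟨h1, h2⟩
    · rintro ⟨h1, rfl⟩
      exact ⟨⟨⟨hH.2.1.2, fun e => hH.2.2 ⟨hy, e⟩⟩, h1⟩, rfl⟩

/-- Every point is on equally many generators. -/
theorem HasOrder.ncard_generators_mem (h : S.HasOrder q t) (x y : P) :
    {M | S.IsGenerator M ∧ x ∈ M}.ncard = {M | S.IsGenerator M ∧ y ∈ M}.ncard := by
  by_cases hxy : S.Collinear x y
  · rw [Set.ncard_eq_ncard_iff_ncard_sdiff_eq_ncard_sdiff]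
    -- Send a generator on `x` but not on `y` to its neighbour on `y`, which contains `x` too. The
    -- fibres over a generator on both points have sizes symmetric in `x` and `y`.
    have key : ∀ x y, S.Collinear x y →
        ∀ M ∈ {M | S.IsGenerator M ∧ x ∈ M} \ {M | S.IsGenerator M ∧ y ∈ M},
        ∃! W, W ∈ {W | S.IsGenerator W ∧ x ∈ W ∧ y ∈ W} ∧ S.GenAdj M W := by
      rintro x y hxy M ⟨⟨hM, hxM⟩, hyM⟩
      have hyM' : y ∉ M := fun e => hyM ⟨hM, e⟩
      obtain ⟨W, hW, hyW, hc⟩ := exists_proj hM hyM'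
      exact ⟨W, ⟨⟨hW.2.1, (hc x hxM).1 hxy, hyW⟩, hW⟩,
        fun W' hW' => hW'.2.eq hW hW'.1.2.2 hyW hyM'⟩
    have key2 : ∀ x y, ∀ W, {M | M ∈ {M | S.IsGenerator M ∧ x ∈ M} \
        {M | S.IsGenerator M ∧ y ∈ M} ∧ S.GenAdj M W} =
        {M | (x ∈ M ∧ y ∉ M) ∧ S.GenAdj W M} := by
      intro x y W
      ext M
      constructor
      · rintro ⟨⟨⟨hM, hxM⟩, hyM⟩, hA⟩
        exact ⟨⟨hxM, fun e => hyM ⟨hM, e⟩⟩, hA.symm⟩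
      · rintro ⟨⟨hxM, hyM⟩, hA⟩
        exact ⟨⟨⟨hA.2.1, hxM⟩, fun e => hyM e.2⟩, hA.symm⟩
    refine Set.ncard_eq_ncard_of_fibers S.GenAdj (key x y hxy) ?_ ?_
    · have := key y x hxy.symm
      simpa only [and_comm (a := y ∈ _)] using this
    · rintro W ⟨hW, hxW, hyW⟩
      rw [key2, key2, h.ncard_genAdj_mem_notMem hW hxW hyW, h.ncard_genAdj_mem_notMem hW hyW hxW,
        h.ncard_hyperplanes_mem_notMem hW.mem hxW hyW]
  -- For non-collinear points, adjacency is a perfect matching between the generators on `x` and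
  -- those on `y`.
  · have key : ∀ x y, ¬ S.Collinear x y → ∀ M ∈ {M | S.IsGenerator M ∧ x ∈ M},
        {W ∈ {W | S.IsGenerator W ∧ y ∈ W} | S.GenAdj M W}.ncard = 1 := by
      rintro x y hxy M ⟨hM, hxM⟩
      refine Set.ncard_eq_one_of_existsUnique ?_
      obtain ⟨W, hW, hu⟩ := existsUnique_genAdj hM (p := y)
        (fun hyM => hxy (collinear_of_mem hM.mem hxM hyM))
      exact ⟨W, ⟨⟨hW.2.2.1, hW.1⟩, hW.2⟩, fun W' hW' => hu W' ⟨hW'.1.2, hW'.2⟩⟩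
    have := Set.ncard_mul_eq_ncard_mul S.GenAdj (key x y hxy) (l := 1) fun W hW => by
      rw [← key y x (fun e => hxy e.symm) W hW]
      congr 1
      ext M
      exact and_congr_right fun _ => ⟨GenAdj.symm, GenAdj.symm⟩
    simpa using this

/-- Double counting of the incident pairs of a point of `A` and a generator. -/
theorem ncard_mul_eq_generators {A : Set P} {g k : ℕ}
    (hg : ∀ x ∈ A, {M | S.IsGenerator M ∧ x ∈ M}.ncard = g)
    (hk : ∀ M, S.IsGenerator M → (A ∩ M).ncard = k) :
    A.ncard * g = {M | S.IsGenerator M}.ncard * k :=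
  Set.ncard_mul_eq_ncard_mul (fun x M => x ∈ M) hg hk

theorem HasOrder.not_isSeparating_iff (h : S.HasOrder q t) (hn : 2 ≤ n) :
    ¬ IsSeparating S.collinearityGraph ↔ ∃ O : Set P, S.IsOvoid O := by
  obtain ⟨M₀, -, hM₀, -, -⟩ := S.exists_disjoint
  replace hM₀ : S.IsGenerator M₀ := hM₀
  obtain ⟨x₀, hx₀⟩ := nonempty_of_rk_pos (S := S) (U := M₀) (by rw [hM₀.rk_eq]; omega)
  obtain ⟨g, hg⟩ : ∃ g, ∀ x, {M | S.IsGenerator M ∧ x ∈ M}.ncard = g :=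
    ⟨_, fun x => h.ncard_generators_mem x x₀⟩
  have hg0 : 0 < g := by
    rw [← hg x₀, Set.ncard_pos]
    exact ⟨M₀, hM₀, hx₀⟩
  have hcard : ∀ M, S.IsGenerator M → M.ncard = M₀.ncard := fun M hM => by
    rw [h.ncard_eq hM.mem, h.ncard_eq hM₀.mem, hM.rk_eq, hM₀.rk_eq]
  have hf0 : 0 < M₀.ncard := (Set.ncard_pos M₀.toFinite).2 ⟨x₀, hx₀⟩
  have htot : Nat.card P * g = {M | S.IsGenerator M}.ncard * M₀.ncard := by
    rw [← Set.ncard_univ]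
    exact ncard_mul_eq_generators (fun x _ => hg x) (fun M hM => by rw [Set.univ_inter, hcard M hM])
  rw [IsSeparating, not_lt]
  constructor
  · intro hle
    obtain ⟨K, hK⟩ := S.collinearityGraph.exists_isNClique_cliqueNum
    obtain ⟨A, hA⟩ := S.collinearityGraph.exists_isNIndepSet_indepNum
    obtain ⟨M, hM, hKM⟩ := exists_isGenerator_superset (S := S) (K := K) fun x hx y hy => by
      by_cases e : x = y
      · exact Or.inl e
      · exact (collinearityGraph_adj.1 (hK.isClique hx hy e)).2
    have hKc : S.collinearityGraph.cliqueNum ≤ M₀.ncard := by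
      rw [← hK.card_eq, ← Set.ncard_coe_finset, ← hcard M hM]
      exact Set.ncard_le_ncard hKM
    have hA1 : ∀ M, S.IsGenerator M → ((A : Set P) ∩ M).Subsingleton := by
      rintro M hM x ⟨hxA, hxM⟩ y ⟨hyA, hyM⟩
      by_contra hne
      exact hA.isIndepSet hxA hyA hne
        (collinearityGraph_adj.2 ⟨hne, collinear_of_mem hM.mem hxM hyM⟩)
    refine ⟨A, fun M hM => ?_⟩
    have hne : ((A : Set P) ∩ M).Nonempty := by
      by_contra hempty
      -- If `M` missed `A`, all incidences with `A` would fall on the other generators, making `α g`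
      -- strictly less than their total number.
      have h1 := Set.ncard_mul_le_ncard_mul (fun (x : P) M => x ∈ M) (s := (A : Set P))
        (t := {M | S.IsGenerator M} \ {M}) (k := g) (l := 1) ?_ ?_
      · rw [Set.ncard_sdiff_singleton_of_mem (a := M) hM, Set.ncard_coe_finset, hA.card_eq] at h1
        have h2 : 0 < {M | S.IsGenerator M}.ncard := (Set.ncard_pos (Set.toFinite _)).2 ⟨M, hM⟩
        have h3 : Nat.card P * g ≤ M₀.ncard * (S.collinearityGraph.indepNum * g) := by
          rw [← mul_assoc]
          exact Nat.mul_le_mul_right _ (hle.trans (Nat.mul_le_mul_right _ hKc))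
        rw [htot, mul_comm] at h3
        have := Nat.le_of_mul_le_mul_left h3 hf0
        omega
      · intro x hx
        rw [← hg x]
        refine Set.ncard_le_ncard fun N hN => ⟨⟨hN.1, fun e => hempty ⟨x, hx, ?_⟩⟩, hN.2⟩
        rw [← show N = M from e]
        exact hN.2
      · rintro N ⟨hN, -⟩
        exact Set.ncard_le_one_iff_subsingleton.2 (hA1 N hN)
    obtain ⟨x, hx⟩ := hne
    exact ⟨x, hx, fun y hy => hA1 M hM hy hx⟩
  · rintro ⟨O, hO⟩
    have h1 : O.ncard * g = {M | S.IsGenerator M}.ncard * 1 :=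
      ncard_mul_eq_generators (fun x _ => hg x) fun M hM => Set.ncard_eq_one_of_existsUnique (hO M hM)
    have hind : S.collinearityGraph.IsIndepSet (O.toFinite.toFinset : Set P) := by
      intro x hx y hy hne hadj
      rw [Set.Finite.coe_toFinset] at hx hy
      obtain ⟨-, L, hL, hxL, hyL⟩ := hadj
      obtain ⟨M, hM, hLM⟩ := exists_isGenerator_superset (S := S) (K := L)
        fun x hx y hy => collinear_of_mem hL.mem hx hy
      exact hne ((hO M hM).unique ⟨hx, hLM hxL⟩ ⟨hy, hLM hyL⟩)
    have hcl : S.collinearityGraph.IsClique (M₀.toFinite.toFinset : Set P) := by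
      intro x hx y hy hne
      rw [Set.Finite.coe_toFinset] at hx hy
      exact collinearityGraph_adj.2 ⟨hne, collinear_of_mem hM₀.mem hx hy⟩
    have h2 := hind.card_le_indepNum
    have h3 := SimpleGraph.IsClique.card_le_cliqueNum (tc := hcl)
    rw [← Set.ncard_eq_toFinset_card] at h2 h3
    refine le_trans ?_ (Nat.mul_le_mul h3 h2)
    refine Nat.le_of_mul_le_mul_right (c := g) ?_ hg0
    rw [htot, mul_assoc, h1, mul_one, mul_comm]

end PolarSpace

/-! ### The dual polar graph: distance two, and order `(q, 1)` -/

namespace PolarSpace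

variable {P : Type*} {n : ℕ} {S : PolarSpace P n}

theorem exists_hyperplane_superset_inter {M N : Set P} (hM : S.IsGenerator M)
    (hN : S.IsGenerator N) (hr : S.rk (M ∩ N) + 2 = n) : ∃ H ∈ S.hyperplanes M, M ∩ N ⊆ H := by
  have hI := S.inter_mem _ hM.mem _ hN.mem
  have hMr := hM.rk_eq
  obtain ⟨x, hxM, hx⟩ := exists_notMem_of_rk_lt hM.mem hI (by omega)
  have h1 := rk_join hM.mem hI Set.inter_subset_left hxM hx
  exact ⟨_, ⟨join_mem hM.mem hI Set.inter_subset_left hxM hx,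
    join_subset hM.mem Set.inter_subset_left hxM, by omega⟩, subset_join _ _⟩

/-- If two generators meet in corank two, every hyperplane of the first one on their intersection
is on a common neighbour of both. -/
theorem exists_common_genAdj {M N H : Set P} (hM : S.IsGenerator M) (hN : S.IsGenerator N)
    (hr : S.rk (M ∩ N) + 2 = n) (hH : H ∈ S.hyperplanes M) (hIH : M ∩ N ⊆ H) :
    ∃ W, S.GenAdj M W ∧ M ∩ W = H ∧ S.GenAdj N W := by
  have hI := S.inter_mem _ hM.mem _ hN.mem
  have hMr := hM.rk_eq
  have hHr := hH.2.2
  obtain ⟨x, hxH, hx⟩ := exists_notMem_of_rk_lt hH.1 hI (by omega)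
  have hxN : x ∉ N := fun e => hx ⟨hH.2.1 hxH, e⟩
  -- The projection of `x` onto `N` contains `x` and `M ∩ N`, which together span `H`.
  obtain ⟨W, hW, hxW, hc⟩ := exists_proj hN hxN
  have hIW : M ∩ N ⊆ W := fun y hy =>
    (hc y hy.2).1 (collinear_of_mem hM.mem hy.1 (hH.2.1 hxH))
  have hJ := join_eq_of_mem_hyperplanes hH.1 ⟨hI, hIH, by omega⟩ hxH hx
  have hHW : H ⊆ W := hJ ▸ join_subset hW.2.1.mem hIW hxW
  have hne : M ≠ W := by
    rintro rfl
    have := hW.2.2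
    rw [Set.inter_comm] at this
    omega
  obtain ⟨h1, h2⟩ := genAdj_of_hyperplane hM hW.2.1 hne hH hHW
  exact ⟨W, h1, h2, hW⟩

theorem GenAdj.le_rk_inter {M N W : Set P} (hM : S.GenAdj M W) (hN : S.GenAdj N W) :
    n ≤ S.rk (M ∩ W ∩ N) + 2 := by
  have h1 := rk_add_rk_le hM.2.1.mem hM.inter_mem.1 hN.inter_mem.1 Set.inter_subset_right
    Set.inter_subset_right
  rw [hM.2.1.rk_eq] at h1
  have h2 : M ∩ W ∩ (N ∩ W) = M ∩ W ∩ N := by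
    ext x
    simp only [Set.mem_inter_iff]
    tauto
  rw [h2] at h1
  have := hM.2.2
  have := hN.2.2
  omega

theorem GenAdj.rk_inter_eq {M N W : Set P} (hM : S.GenAdj M W) (hN : S.GenAdj N W) (hne : M ≠ N)
    (hnadj : ¬ S.GenAdj M N) : S.rk (M ∩ N) + 2 = n := by
  have hI := S.inter_mem _ hM.1.mem _ hN.1.mem
  have h1 := hM.le_rk_inter hN
  have h2 := rk_mono (S.inter_mem _ hM.inter_mem.1 _ hN.1.mem) hI
    (Set.inter_subset_inter_left _ Set.inter_subset_left)
  have h3 := rk_lt_rk hI hM.1.mem (Set.inter_subset_left.ssubset_of_ne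
    fun h => hne (hM.1.eq_of_subset hN.1 (Set.inter_eq_left.1 h)))
  rw [hM.1.rk_eq] at h3
  have h4 : S.rk (M ∩ N) + 1 ≠ n := fun h => hnadj ⟨hM.1, hN.1, h⟩
  omega

theorem distanceTwoGraph_adj {M N : {M : Set P // S.IsGenerator M}} :
    (distanceTwoGraph S.dualPolarGraph).Adj M N ↔ S.rk (M.1 ∩ N.1) + 2 = n := by
  have e : (distanceTwoGraph S.dualPolarGraph).Adj M N ↔ S.dualPolarGraph.edist M N = 2 := by
    simp only [distanceTwoGraph, SimpleGraph.dist]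
    -- `dist` is 0 for unreachable pairs; as `2 ≠ 0`, passing to `edist` loses nothing.
    rw [ENat.toNat_eq_iff (by norm_num)]
    rfl
  rw [e, SimpleGraph.edist_eq_two_iff, dualPolarGraph_adj]
  constructor
  · rintro ⟨hne, hnadj, W, hW⟩
    rw [SimpleGraph.mem_commonNeighbors, dualPolarGraph_adj, dualPolarGraph_adj] at hW
    exact hW.1.rk_inter_eq hW.2 (fun e => hne (Subtype.ext e)) hnadj
  · intro hr
    refine ⟨?_, fun h => ?_, ?_⟩
    · rintro rfl
      rw [Set.inter_self, M.2.rk_eq] at hr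
      omega
    · have := h.2.2
      omega
    · obtain ⟨H, hH, hIH⟩ := exists_hyperplane_superset_inter M.2 N.2 hr
      obtain ⟨W, h1, -, h2⟩ := exists_common_genAdj M.2 N.2 hr hH hIH
      refine ⟨⟨W, h1.2.1⟩, ?_⟩
      rw [SimpleGraph.mem_commonNeighbors, dualPolarGraph_adj, dualPolarGraph_adj]
      exact ⟨h1, h2⟩

variable [Finite P] {q t : ℕ}

theorem HasOrder.one_le (h : S.HasOrder q t) (hn : 2 ≤ n) : 1 ≤ q := by
  obtain ⟨M, -, hM, -, -⟩ := S.exists_disjoint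
  replace hM : S.IsGenerator M := hM
  have hr := hM.rk_eq
  obtain ⟨x, hx, hx'⟩ := exists_notMem_of_rk_lt hM.mem S.empty_mem (by rw [rk_empty]; omega)
  have h1 := rk_join hM.mem S.empty_mem (Set.empty_subset _) hx hx'
  rw [rk_empty] at h1
  obtain ⟨y, hy, hy'⟩ := exists_notMem_of_rk_lt hM.mem
    (join_mem hM.mem S.empty_mem (Set.empty_subset _) hx hx') (by omega)
  have hxy : x ≠ y := fun e => hy' (e ▸ mem_join_self _ _)
  obtain ⟨L, hL, -, hxL, hyL⟩ := exists_isLine hM.mem hx hy hxy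
  have h2 := (Set.one_lt_ncard L.toFinite).2 ⟨x, hxL, y, hyL, hxy⟩
  rw [h.ncard_line hL] at h2
  omega

theorem HasOrder.ncard_genAdj_eq (h : S.HasOrder q t) {M : Set P} (hM : S.IsGenerator M) :
    {N | S.GenAdj M N}.ncard = pointCount q n * t := by
  have h1 := h.ncard_hyperplanes hM.mem
  rw [hM.rk_eq] at h1
  rw [← h1, ← mul_one (Set.ncard {N | S.GenAdj M N})]
  refine Set.ncard_mul_eq_ncard_mul (fun N H => M ∩ N = H) (fun N hN => ?_)
    (fun H hH => h.ncard_genAdj hM hH)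
  exact Set.ncard_eq_one_of_existsUnique ⟨M ∩ N, ⟨hN.inter_mem, rfl⟩, fun H hH => hH.2.symm⟩

theorem HasOrder.eq_of_inter_eq (h : S.HasOrder q 1) {M N N' : Set P} (hN : S.GenAdj M N)
    (hN' : S.GenAdj M N') (he : M ∩ N = M ∩ N') : N = N' := by
  obtain ⟨W, hW⟩ := Set.ncard_eq_one.1 (h.ncard_genAdj hN.1 hN.inter_mem)
  have h1 : N ∈ ({W} : Set (Set P)) := hW ▸ ⟨hN, rfl⟩
  have h2 : N' ∈ ({W} : Set (Set P)) := hW ▸ ⟨hN', he.symm⟩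
  exact h1.trans h2.symm

/-- The dual polar graph of a polar space of order `(q, 1)` has no triangles. -/
theorem HasOrder.not_genAdj (h : S.HasOrder q 1) {M N W : Set P} (hM : S.GenAdj M W)
    (hN : S.GenAdj N W) : ¬ S.GenAdj M N := by
  intro hMN
  -- As `t = 1`, the two hyperplanes of `M` differ and so span `M`. Points of `N ∩ W` are collinear
  -- with both, hence lie in `M`, and all three generators share a hyperplane.
  have hne : M ∩ W ≠ M ∩ N := fun e => hN.ne (h.eq_of_inter_eq hMN hM e.symm)
  have hr := rk_inter_hyperplanes hM.1.mem hM.inter_mem hMN.inter_mem hne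
  have hMr := hM.1.rk_eq
  have hsub : N ∩ W ⊆ M := fun y hy => by
    refine mem_of_forall_collinear_sup hM.1 hM.inter_mem.1 hMN.inter_mem.1 Set.inter_subset_left
      Set.inter_subset_left ?_ (fun x hx => collinear_of_mem hM.2.1.mem hx.2 hy.2)
      (fun x hx => collinear_of_mem hMN.2.1.mem hx.2 hy.1)
    have := hM.2.2
    have := hMN.2.2
    omega
  have he : W ∩ N = W ∩ M := by
    refine eq_of_subset_of_rk_le hN.symm.inter_mem.1 hM.symm.inter_mem.1
      (fun y hy => ⟨hy.1, hsub ⟨hy.2, hy.1⟩⟩) ?_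
    have := hM.symm.2.2
    have := hN.symm.2.2
    omega
  exact hMN.ne (h.eq_of_inter_eq hM.symm hN.symm he.symm)

theorem HasOrder.rk_inter_eq (h : S.HasOrder q 1) {M N W : Set P} (hM : S.GenAdj M W)
    (hN : S.GenAdj N W) (hne : M ≠ N) : S.rk (M ∩ N) + 2 = n :=
  hM.rk_inter_eq hN hne (h.not_genAdj hM hN)

/-- Common neighbours correspond to the hyperplanes of `M` on `M ∩ N`: each such hyperplane is on
exactly one generator other than `M`. -/
theorem HasOrder.ncard_common_genAdj (h : S.HasOrder q 1) {M N : Set P} (hM : S.IsGenerator M)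
    (hN : S.IsGenerator N) (hr : S.rk (M ∩ N) + 2 = n) :
    {W | S.GenAdj M W ∧ S.GenAdj N W}.ncard = q + 1 := by
  have hI := S.inter_mem _ hM.mem _ hN.mem
  rw [← h.ncard_hyperplanes_superset hM.mem hI Set.inter_subset_left (by rw [hM.rk_eq]; exact hr),
    ← mul_one (Set.ncard _), ← mul_one (Set.ncard {H ∈ S.hyperplanes M | M ∩ N ⊆ H})]
  refine Set.ncard_mul_eq_ncard_mul (fun W H => M ∩ W = H) (fun W hW => ?_) (fun H hH => ?_)
  · refine Set.ncard_eq_one_of_existsUnique ⟨M ∩ W, ⟨⟨hW.1.inter_mem, ?_⟩, rfl⟩,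
      fun H hH => hH.2.symm⟩
    have h1 := hW.1.le_rk_inter hW.2
    have h2 := eq_of_subset_of_rk_le (S.inter_mem _ hW.1.inter_mem.1 _ hN.mem) hI
      (Set.inter_subset_inter_left _ Set.inter_subset_left) (by omega)
    exact h2 ▸ Set.inter_subset_left
  · obtain ⟨W, h1, h2, h3⟩ := exists_common_genAdj hM hN hr hH.1 hH.2
    exact Set.ncard_eq_one_of_existsUnique ⟨W, ⟨⟨h1, h3⟩, h2⟩,
      fun W' hW' => h.eq_of_inter_eq hW'.1.1 h1 (hW'.2.trans h2.symm)⟩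

/-- Take a hyperplane `H` of `M` on `U` and the other generator `W` on `H`. Every `N` in question is
adjacent to `W` and is determined by `W ∩ N`, one of the `q` hyperplanes of `W` on `U` other than
`H`. -/
theorem HasOrder.ncard_inter_eq_le (h : S.HasOrder q 1) {M U : Set P} (hM : S.IsGenerator M)
    (hr : S.rk U + 2 = n) : {N | S.IsGenerator N ∧ M ∩ N = U}.ncard ≤ q := by
  rcases Set.eq_empty_or_nonempty {N | S.IsGenerator N ∧ M ∩ N = U} with he | ⟨N₀, hN₀, rfl⟩
  · rw [he, Set.ncard_empty]
    exact Nat.zero_le _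
  have hI := S.inter_mem _ hM.mem _ hN₀.mem
  obtain ⟨H, hH, hIH⟩ := exists_hyperplane_superset_inter hM hN₀ hr
  obtain ⟨W, hW, hWH, -⟩ := exists_common_genAdj hM hN₀ hr hH hIH
  have hadj : ∀ N, S.IsGenerator N → M ∩ N = M ∩ N₀ → S.GenAdj W N := fun N hN he => by
    obtain ⟨W', h1, h2, h3⟩ := exists_common_genAdj hM hN (he ▸ hr) hH (he ▸ hIH)
    rw [h.eq_of_inter_eq hW h1 (hWH.trans h2.symm)]
    exact h3.symm
  have hUW : M ∩ N₀ ⊆ W := hIH.trans (hWH ▸ Set.inter_subset_right)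
  have hHW : H ∈ {H ∈ S.hyperplanes W | M ∩ N₀ ⊆ H} := by
    refine ⟨?_, hIH⟩
    rw [← hWH, Set.inter_comm]
    exact hW.symm.inter_mem
  have hc : ({H ∈ S.hyperplanes W | M ∩ N₀ ⊆ H} \ {H}).ncard = q := by
    rw [Set.ncard_sdiff_singleton_of_mem hHW, h.ncard_hyperplanes_superset hW.2.1.mem hI hUW
      (by rw [hW.2.1.rk_eq]; exact hr)]
    omega
  rw [← hc]
  refine Set.ncard_le_ncard_of_injOn (fun N => W ∩ N) ?_ ?_
  · rintro N ⟨hN, he⟩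
    refine ⟨⟨(hadj N hN he).inter_mem, Set.subset_inter hUW (he ▸ Set.inter_subset_right)⟩, ?_⟩
    intro e
    have e' : W ∩ N = H := e
    have h1 : H ⊆ M ∩ N₀ := he ▸ Set.subset_inter hH.2.1 (e' ▸ Set.inter_subset_right)
    have h2 := rk_mono hH.1 hI h1
    have h3 := hH.2.2
    have h4 := hM.rk_eq
    omega
  · rintro N ⟨hN, he⟩ N' ⟨hN', he'⟩ e
    exact h.eq_of_inter_eq (hadj N hN he) (hadj N' hN' he') e

end PolarSpace

/-! ### Planes pairwise meeting in lines -/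

namespace PolarSpace

variable {P : Type*} {n : ℕ} {S : PolarSpace P n}

/-- If two members of a family of planes that pairwise meet in lines span a solid not containing a
third plane, then the third plane is on the intersection of the first two. -/
theorem inter_subset_of_not_subset {A B C J : Set P} (hA : A ∈ S.subspaces) (hB : B ∈ S.subspaces)
    (hC : C ∈ S.subspaces) (hJ : J ∈ S.subspaces) (hAJ : A ⊆ J) (hBJ : B ⊆ J)
    (hrC : S.rk C = 3) (hAB : S.rk (A ∩ B) = 2) (hAC : 2 ≤ S.rk (C ∩ A)) (hBC : 2 ≤ S.rk (C ∩ B))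
    (hCJ : ¬ C ⊆ J) : A ∩ B ⊆ C := by
  have hCJm := S.inter_mem _ hC _ hJ
  -- `C ∩ J` has rank at most 2, so it coincides with both `C ∩ A` and `C ∩ B`, and hence with the
  -- line `A ∩ B`.
  have h1 := rk_lt_rk hCJm hC
    (Set.inter_subset_left.ssubset_of_ne fun e => hCJ (Set.inter_eq_left.1 e))
  have eA := eq_of_subset_of_rk_le (S.inter_mem _ hC _ hA) hCJm
    (Set.inter_subset_inter_right _ hAJ) (by omega)
  have eB := eq_of_subset_of_rk_le (S.inter_mem _ hC _ hB) hCJm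
    (Set.inter_subset_inter_right _ hBJ) (by omega)
  have hsub : C ∩ J ⊆ A ∩ B :=
    Set.subset_inter (eA ▸ Set.inter_subset_right) (eB ▸ Set.inter_subset_right)
  have h2 := rk_mono (S.inter_mem _ hC _ hA) hCJm (Set.inter_subset_inter_right _ hAJ)
  rw [← eq_of_subset_of_rk_le hCJm (S.inter_mem _ hA _ hB) hsub (by omega)]
  exact Set.inter_subset_left

theorem one_le_pointCount_succ (q d : ℕ) : 1 ≤ pointCount q (d + 1) := by
  rw [pointCount]
  omega

/-- A family of planes of a projective space of rank five that pairwise meet in lines is contained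
in a solid or consists of planes on a line. -/
theorem subset_or_inter_subset {V A B J : Set P} {F : Set (Set P)} (hV : V ∈ S.subspaces)
    (hr : S.rk V = 5) (hF : ∀ U ∈ F, U ∈ S.subspaces ∧ U ⊆ V ∧ S.rk U = 3)
    (hF2 : ∀ U ∈ F, ∀ U' ∈ F, 2 ≤ S.rk (U ∩ U')) (hA : A ∈ F) (hB : B ∈ F)
    (hJ : J ∈ S.subspaces) (hJV : J ⊆ V) (hrJ : S.rk J = 4) (hAJ : A ⊆ J) (hBJ : B ⊆ J)
    (hAB : S.rk (A ∩ B) = 2) :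
    (∀ C ∈ F, C ⊆ J) ∨ ∀ C ∈ F, A ∩ B ⊆ C := by
  by_contra! hcon
  obtain ⟨⟨C, hC, hCJ⟩, D, hD, hD'⟩ := hcon
  obtain ⟨hAm, hAV, hrA⟩ := hF A hA
  obtain ⟨hBm, hBV, hrB⟩ := hF B hB
  obtain ⟨hCm, hCV, hrC⟩ := hF C hC
  obtain ⟨hDm, hDV, hrD⟩ := hF D hD
  have hABC : A ∩ B ⊆ C := inter_subset_of_not_subset hAm hBm hCm hJ hAJ hBJ hrC hAB
    (hF2 C hC A hA) (hF2 C hC B hB) hCJ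
  have hDJ : D ⊆ J := by
    by_contra hDJ
    exact hD' (inter_subset_of_not_subset hAm hBm hDm hJ hAJ hBJ hrD hAB
      (hF2 D hD A hA) (hF2 D hD B hB) hDJ)
  have hACm := S.inter_mem _ hAm _ hCm
  have hAC : S.rk (A ∩ C) = 2 := by
    have h1 := hF2 A hA C hC
    have h2 : S.rk (A ∩ C) < S.rk C := rk_lt_rk hACm hCm
      (Set.inter_subset_right.ssubset_of_ne fun e => hCJ ((Set.inter_eq_right.1 e).trans hAJ))
    omega
  have hABAC : A ∩ B = A ∩ C := eq_of_subset_of_rk_le (S.inter_mem _ hAm _ hBm) hACm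
    (Set.subset_inter Set.inter_subset_left hABC) (by omega)
  -- `A` and `C` meet in the same line and span a second solid `K`. As `D` misses part of that line,
  -- it lies in both solids, and so does `A`; but `J ∩ K` is only a plane, so `D = A`.
  obtain ⟨K, hK, hAK, hCK, hKmin, hKr⟩ := exists_sup hV hAm hCm hAV hCV
  have hDK : D ⊆ K := by
    by_contra hDK
    exact hD' (hABAC ▸ inter_subset_of_not_subset hAm hCm hDm hK hAK hCK hrD hAC
      (hF2 D hD A hA) (hF2 D hD C hC) hDK)
  have hJK : S.rk (J ∩ K) + 2 = S.rk V := rk_inter_hyperplanes hV ⟨hJ, hJV, by omega⟩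
    ⟨hK, hKmin V hV hAV hCV, by omega⟩ (fun e => hCJ (e ▸ hCK))
  have hJKm := S.inter_mem _ hJ _ hK
  have e1 := eq_of_subset_of_rk_le hAm hJKm (Set.subset_inter hAJ hAK) (by omega)
  have e2 := eq_of_subset_of_rk_le hDm hJKm (Set.subset_inter hDJ hDK) (by omega)
  rw [e2, ← e1] at hD'
  exact hD' Set.inter_subset_left

variable [Finite P] {q t : ℕ}

theorem HasOrder.ncard_planes_le (h : S.HasOrder q t) (hq : 1 ≤ q) {V : Set P}
    {F : Set (Set P)} (hV : V ∈ S.subspaces)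
    (hr : S.rk V = 5) (hF : ∀ U ∈ F, U ∈ S.subspaces ∧ U ⊆ V ∧ S.rk U = 3)
    (hF2 : ∀ U ∈ F, ∀ U' ∈ F, 2 ≤ S.rk (U ∩ U')) : F.ncard ≤ pointCount q 4 := by
  by_cases hsub : F.Subsingleton
  · exact (Set.ncard_le_one_iff_subsingleton.2 hsub).trans (one_le_pointCount_succ q 3)
  obtain ⟨A, hA, B, hB, hne⟩ := Set.not_subsingleton_iff.1 hsub
  obtain ⟨hAm, hAV, hrA⟩ := hF A hA
  obtain ⟨hBm, hBV, hrB⟩ := hF B hB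
  obtain ⟨J, hJ, hAJ, hBJ, hJmin, hJr⟩ := exists_sup hV hAm hBm hAV hBV
  have hABm := S.inter_mem _ hAm _ hBm
  have hAB : S.rk (A ∩ B) = 2 := by
    have h1 := hF2 A hA B hB
    have h2 : S.rk (A ∩ B) < S.rk A := rk_lt_rk hABm hAm
      (Set.inter_subset_left.ssubset_of_ne fun e => hne
        (eq_of_subset_of_rk_le hAm hBm (Set.inter_eq_left.1 e) (by omega)))
    omega
  rcases subset_or_inter_subset hV hr hF hF2 hA hB hJ (hJmin V hV hAV hBV) (by omega) hAJ hBJ hAB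
    with hall | hall
  · have h1 := h.ncard_hyperplanes hJ
    rw [show S.rk J = 4 by omega] at h1
    rw [← h1]
    refine Set.ncard_le_ncard fun U hU => ⟨(hF U hU).1, hall U hU, ?_⟩
    have := (hF U hU).2.2
    omega
  -- Off the common line, the planes are disjoint sets of `q ^ 2` points among `q ^ 2 + q ^ 3 + q ^
  -- 4`.
  · have key := Set.ncard_mul_le_ncard_mul (fun (U : Set P) x => x ∈ U) (s := F)
      (t := V \ (A ∩ B)) (k := q ^ 2) (l := 1) ?_ ?_
    · have h1 := Set.ncard_sdiff_add_ncard_of_subset (Set.inter_subset_left.trans hAV : A ∩ B ⊆ V)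
      rw [h.ncard_eq hV, h.ncard_eq hABm, hr, hAB] at h1
      simp only [pointCount] at h1 ⊢
      have h2 : F.ncard * q ^ 2 ≤ (q ^ 2 + q + 1) * q ^ 2 := by
        nlinarith
      have h3 := Nat.le_of_mul_le_mul_right h2 (by positivity)
      nlinarith [Nat.zero_le (q ^ 3)]
    · intro U hU
      obtain ⟨hUm, hUV, hrU⟩ := hF U hU
      have h1 := Set.ncard_sdiff_add_ncard_of_subset (hall U hU)
      rw [h.ncard_eq hUm, h.ncard_eq hABm, hrU, hAB] at h1
      have h2 : {x | x ∈ V \ (A ∩ B) ∧ x ∈ U} = U \ (A ∩ B) := by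
        ext x
        exact ⟨fun hx => ⟨hx.2, hx.1.2⟩, fun hx => ⟨⟨hUV hx.1, hx.2⟩, hx.1⟩⟩
      rw [h2]
      simp only [pointCount] at h1
      nlinarith
    · rintro x ⟨hxV, hx⟩
      refine Set.ncard_le_one_iff_subsingleton.2 ?_
      have hJ' : ∀ U ∈ F, x ∈ U → S.join (A ∩ B) x = U := fun U hU hxU =>
        join_eq_of_mem_hyperplanes (hF U hU).1 ⟨hABm, hall U hU, by rw [hAB, (hF U hU).2.2]⟩ hxU hx
      rintro U ⟨hU, hxU⟩ U' ⟨hU', hxU'⟩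
      rw [← hJ' U hU hxU, hJ' U' hU' hxU']

end PolarSpace

/-! ### Clique and coclique bounds in rank 5 (c) -/

namespace PolarSpace

variable {P : Type*} {S : PolarSpace P 5} [Finite P] {q : ℕ}

/-- Generators of a polar space of rank `5` that pairwise meet in planes. -/
theorem HasOrder.ncard_clique_le (h : S.HasOrder q 1) {K : Set (Set P)}
    (hK : ∀ M ∈ K, S.IsGenerator M) (hK2 : ∀ M ∈ K, ∀ N ∈ K, M ≠ N → S.rk (M ∩ N) = 3) :
    K.ncard ≤ pointCount q 5 := by
  rcases K.eq_empty_or_nonempty with rfl | ⟨M, hM⟩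
  · simp
  have hMg := hK M hM
  have hMr := hMg.rk_eq
  have h1 := Set.ncard_mul_le_ncard_mul (fun N U : Set P => M ∩ N = U) (s := K \ {M})
    (t := (fun N => M ∩ N) '' (K \ {M})) (k := 1) (l := q) ?_ ?_
  · have h2 : ((fun N => M ∩ N) '' (K \ {M})).ncard ≤ pointCount q 4 := by
      refine h.ncard_planes_le (h.one_le (by norm_num)) hMg.mem hMr ?_ ?_
      · rintro _ ⟨N, ⟨hN, hne⟩, rfl⟩
        exact ⟨S.inter_mem _ hMg.mem _ (hK N hN).mem, Set.inter_subset_left,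
          hK2 M hM N hN (Ne.symm hne)⟩
      · rintro _ ⟨N, ⟨hN, hne⟩, rfl⟩ _ ⟨N', ⟨hN', hne'⟩, rfl⟩
        have hMN := S.inter_mem _ hMg.mem _ (hK N hN).mem
        have hMN' := S.inter_mem _ hMg.mem _ (hK N' hN').mem
        have r1 := hK2 M hM N hN (Ne.symm hne)
        have r2 := hK2 M hM N' hN' (Ne.symm hne')
        by_cases e : N = N'
        · subst e
          simp only [Set.inter_self]
          omega
        -- Planes of `M` meeting in at most a point span `M`. Then `N ∩ N' ⊆ M`, so the plane `N ∩
        -- N'` would lie in an intersection of rank at most 1.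
        by_contra! hlt
        have hsub : N ∩ N' ⊆ M := fun x hx => mem_of_forall_collinear_sup hMg hMN hMN'
          Set.inter_subset_left Set.inter_subset_left (by omega)
          (fun y hy => collinear_of_mem (hK N hN).mem hy.2 hx.1)
          (fun y hy => collinear_of_mem (hK N' hN').mem hy.2 hx.2)
        have r3 := hK2 N hN N' hN' e
        have r4 := rk_mono (S.inter_mem _ (hK N hN).mem _ (hK N' hN').mem)
          (S.inter_mem _ hMN _ hMN')
          (fun x hx => ⟨⟨hsub hx, hx.1⟩, hsub hx, hx.2⟩)
        omega
    rw [Set.ncard_sdiff_singleton_of_mem hM] at h1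
    have h3 := Nat.mul_le_mul_right q h2
    rw [pointCount, mul_comm q]
    omega
  · intro N hN
    exact (Set.ncard_pos (Set.toFinite _)).2 ⟨M ∩ N, ⟨N, hN, rfl⟩, rfl⟩
  · rintro _ ⟨N, ⟨hN, hne⟩, rfl⟩
    refine le_trans (Set.ncard_le_ncard ?_) (h.ncard_inter_eq_le hMg (U := M ∩ N) ?_)
    · rintro N' ⟨⟨hN', -⟩, he⟩
      exact ⟨hK N' hN', he⟩
    · rw [hK2 M hM N hN (Ne.symm hne)]

/-- A set of generators closed under meeting in planes that contains a coclique. -/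
theorem HasOrder.ncard_coclique_mul_lt (h : S.HasOrder q 1) {V A : Set (Set P)}
    (hV : ∀ M ∈ V, S.IsGenerator M) (hne : V.Nonempty)
    (hV2 : ∀ M ∈ V, ∀ N, S.IsGenerator N → S.rk (M ∩ N) = 3 → N ∈ V) (hAV : A ⊆ V)
    (hA : ∀ M ∈ A, ∀ N ∈ A, M ≠ N → S.rk (M ∩ N) ≠ 3) :
    A.ncard * pointCount q 5 < V.ncard := by
  have hq := h.one_le (by norm_num)
  -- Written so as to show the residue 1 modulo `q + 1`.
  have hf : pointCount q 5 = 1 + (q + 1) * (q ^ 3 + q) := by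
    simp only [pointCount]
    ring
  have hnb : ∀ M, S.IsGenerator M → {N | S.GenAdj M N}.ncard = pointCount q 5 := fun M hM => by
    rw [h.ncard_genAdj_eq hM, mul_one]
  have hcl : ∀ M N W, S.GenAdj M W → S.GenAdj N W → M ≠ N → S.rk (M ∩ N) = 3 :=
    fun M N W hM hN hne => by
      have := h.rk_inter_eq hM hN hne
      omega
  -- All neighbours of members of `V'` are back in `V`, so adjacency between `V` and `V'` is regular
  -- of the same valency on both sides.
  set V' : Set (Set P) := {N | ∃ M ∈ V, S.GenAdj M N}
  have hVV' : V.ncard = V'.ncard := by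
    refine Nat.eq_of_mul_eq_mul_right (one_le_pointCount_succ q 4)
      (Set.ncard_mul_eq_ncard_mul S.GenAdj (fun M hM => ?_) (fun N hN => ?_))
    · rw [← hnb M (hV M hM)]
      congr 1
      ext N
      exact ⟨fun hN => hN.2, fun hN => ⟨⟨M, hM, hN⟩, hN⟩⟩
    · obtain ⟨M₀, hM₀, hMN⟩ := hN
      rw [← hnb N hMN.2.1]
      congr 1
      ext M
      refine ⟨fun hM => hM.2.symm, fun hM => ⟨?_, hM.symm⟩⟩
      by_cases e : M₀ = M
      · exact e ▸ hM₀
      · exact hV2 M₀ hM₀ M hM.2.1 (hcl M₀ M N hMN hM.symm e)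
  have hsub : ∀ N, {M | M ∈ A ∧ S.GenAdj M N}.Subsingleton := by
    rintro N M ⟨hM, hMN⟩ M' ⟨hM', hMN'⟩
    by_contra e
    exact hA M hM M' hM' e (hcl M M' N hMN hMN' e)
  have habove : ∀ M ∈ A, {N | N ∈ V' ∧ S.GenAdj M N} = {N | S.GenAdj M N} := fun M hM => by
    ext N
    exact ⟨fun hN => hN.2, fun hN => ⟨⟨M, hAV hM, hN⟩, hN⟩⟩
  by_contra! hle
  -- Under the contrary assumption `hle`, the disjoint neighbourhoods of the members of `A` must
  -- exhaust `V'`.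
  have hex : ∀ N ∈ V', ∃ M ∈ A, S.GenAdj M N := by
    intro N hN
    by_contra! hno
    have h1 := Set.ncard_mul_le_ncard_mul S.GenAdj (s := A) (t := V' \ {N})
      (k := pointCount q 5) (l := 1) ?_ ?_
    · rw [Set.ncard_sdiff_singleton_of_mem hN] at h1
      have := (Set.ncard_pos V'.toFinite).2 ⟨N, hN⟩
      omega
    · intro M hM
      rw [← hnb M (hV M (hAV hM)), ← habove M hM]
      refine Set.ncard_le_ncard fun N' hN' => ⟨⟨hN'.1, fun e => hno M hM ?_⟩, hN'.2⟩
      exact (show N' = N from e) ▸ hN'.2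
    · exact fun N' _ => Set.ncard_le_one_iff_subsingleton.2 (hsub N')
  -- If `A` were all of `V`, disjointness of neighbourhoods would force valency at most 1.
  obtain ⟨X, hX, hXA⟩ : ∃ X ∈ V, X ∉ A := by
    by_contra! hall
    obtain rfl := hAV.antisymm hall
    have h1 := Set.ncard_mul_le_ncard_mul S.GenAdj (s := A) (t := V')
      (k := pointCount q 5) (l := 1) (fun M hM => by rw [habove M hM, hnb M (hV M hM)])
      (fun N' _ => Set.ncard_le_one_iff_subsingleton.2 (hsub N'))
    have h2 := (Set.ncard_pos A.toFinite).2 hne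
    rw [← hVV'] at h1
    have h3 := Nat.le_of_mul_le_mul_left h1 h2
    have : 0 < (q + 1) * (q ^ 3 + q) := by positivity
    omega
  -- Each neighbour of `X` has exactly one neighbour in `A`, and each member of `A` so reached
  -- shares `q + 1` neighbours with `X`. Hence `q + 1` divides the valency.
  have hmain := Set.ncard_mul_eq_ncard_mul (fun N M => S.GenAdj M N) (s := {N | S.GenAdj X N})
    (t := {M ∈ A | ∃ N, S.GenAdj X N ∧ S.GenAdj M N}) (k := 1) (l := q + 1) ?_ ?_
  · rw [hnb X (hV X hX), hf, mul_one] at hmain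
    have h1 : (q + 1) ∣ 1 := by
      rw [← Nat.dvd_add_left (Dvd.intro (q ^ 3 + q) rfl), hmain]
      exact Dvd.intro_left _ rfl
    have := Nat.le_of_dvd one_pos h1
    omega
  · intro N hN
    obtain ⟨M, hM, hMN⟩ := hex N ⟨X, hX, hN⟩
    exact Set.ncard_eq_one_of_existsUnique ⟨M, ⟨⟨hM, N, hN, hMN⟩, hMN⟩,
      fun M' hM' => hsub N ⟨hM'.1.1, hM'.2⟩ ⟨hM, hMN⟩⟩
  · rintro M ⟨hM, N, hXN, hMN⟩
    exact h.ncard_common_genAdj (hV X hX) (hV M (hAV hM))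
      (h.rk_inter_eq hXN hMN (fun e => hXA (e ▸ hM)))

theorem HasOrder.isSeparating_component (h : S.HasOrder q 1)
    (C : (distanceTwoGraph S.dualPolarGraph).ConnectedComponent) :
    IsSeparating C.toSimpleGraph := by
  have hadj : ∀ x y : C, C.toSimpleGraph.Adj x y ↔ S.rk (x.1.1 ∩ y.1.1) = 3 := fun x y => by
    rw [SimpleGraph.ConnectedComponent.toSimpleGraph_adj, distanceTwoGraph_adj]
    omega
  have hinj : Function.Injective (fun x : C => x.1.1) :=
    Subtype.val_injective.comp Subtype.val_injective
  obtain ⟨K, hK⟩ := C.toSimpleGraph.exists_isNClique_cliqueNum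
  obtain ⟨A, hA⟩ := C.toSimpleGraph.exists_isNIndepSet_indepNum
  have h1 : C.toSimpleGraph.cliqueNum ≤ pointCount q 5 := by
    rw [← hK.card_eq, ← Set.ncard_coe_finset, ← Set.ncard_image_of_injective _ hinj]
    refine h.ncard_clique_le ?_ ?_
    · rintro _ ⟨x, -, rfl⟩
      exact x.1.2
    · rintro _ ⟨x, hx, rfl⟩ _ ⟨y, hy, rfl⟩ hne
      exact (hadj x y).1 (hK.isClique hx hy fun e => hne (e ▸ rfl))
  have h2 : C.toSimpleGraph.indepNum * pointCount q 5 < Nat.card C := by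
    rw [← hA.card_eq, ← Set.ncard_coe_finset, ← Set.ncard_image_of_injective _ hinj,
      ← Set.ncard_univ, ← Set.ncard_image_of_injective Set.univ hinj]
    refine h.ncard_coclique_mul_lt ?_ ?_ ?_ (Set.image_mono (Set.subset_univ _)) ?_
    · rintro _ ⟨x, -, rfl⟩
      exact x.1.2
    · obtain ⟨x, hx⟩ := C.nonempty_supp
      exact ⟨x.1, ⟨x, hx⟩, trivial, rfl⟩
    · rintro _ ⟨x, -, rfl⟩ N hN hr
      have hxN : (distanceTwoGraph S.dualPolarGraph).Adj x.1 ⟨N, hN⟩ := by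
        rw [distanceTwoGraph_adj]
        exact congrArg (· + 2) hr
      exact ⟨⟨⟨N, hN⟩, C.mem_supp_of_adj_mem_supp x.2 hxN⟩, trivial, rfl⟩
    · rintro _ ⟨x, hx, rfl⟩ _ ⟨y, hy, rfl⟩ hne hr
      exact hA.isIndepSet hx hy (fun e => hne (e ▸ rfl)) ((hadj x y).2 hr)
  calc _ ≤ pointCount q 5 * C.toSimpleGraph.indepNum := Nat.mul_le_mul_right _ h1
    _ < _ := by rw [mul_comm]; exact h2

end PolarSpace

/-! ### Triangular graphs (a) -/

section TriangularGraph

variable {n : ℕ}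

theorem triangularGraph_adj {e f : (⊤ : SimpleGraph (Fin n)).edgeSet} :
    (triangularGraph n).Adj e f ↔ e ≠ f ∧ ∃ v, v ∈ (e : Sym2 (Fin n)) ∧ v ∈ (f : Sym2 (Fin n)) :=
  SimpleGraph.lineGraph_adj_iff_exists

theorem card_toFinset_edge (e : (⊤ : SimpleGraph (Fin n)).edgeSet) : e.1.toFinset.card = 2 :=
  Sym2.card_toFinset_of_not_isDiag _ (SimpleGraph.not_isDiag_of_mem_edgeSet _ e.2)

theorem card_edgeSet_top (n : ℕ) :
    Nat.card (⊤ : SimpleGraph (Fin n)).edgeSet = n.choose 2 := by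
  rw [Nat.card_eq_fintype_card, ← SimpleGraph.edgeFinset_card,
    SimpleGraph.card_edgeFinset_top_eq_card_choose_two, Fintype.card_fin]

theorem cliqueNum_triangularGraph_le (hn : 4 ≤ n) : (triangularGraph n).cliqueNum ≤ n - 1 := by
  classical
  obtain ⟨K, hK⟩ := (triangularGraph n).exists_isNClique_cliqueNum
  have hinj : Function.Injective
      (fun e : (⊤ : SimpleGraph (Fin n)).edgeSet => e.1.toFinset) := fun e f h =>
    Subtype.ext (Sym2.ext fun v => by
      rw [← Sym2.mem_toFinset, ← Sym2.mem_toFinset]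
      exact Finset.ext_iff.1 h v)
  rw [← hK.card_eq, ← Finset.card_image_of_injective K hinj, ← Nat.choose_one_right (n - 1)]
  -- The side condition `2 ≤ n / 2` is where `4 ≤ n` enters; for `n = 3` a triangle would beat the
  -- star.
  refine Finset.erdos_ko_rado (r := 2) ?_ ?_ (by omega)
  · intro a ha b hb hab
    simp only [Finset.coe_image, Set.mem_image, Finset.mem_coe] at ha hb
    obtain ⟨e, he, rfl⟩ := ha
    obtain ⟨f, hf, rfl⟩ := hb
    by_cases hef : e = f
    · subst hef
      rw [disjoint_self, Finset.bot_eq_empty, ← Finset.card_eq_zero, card_toFinset_edge] at hab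
      omega
    · obtain ⟨-, v, hve, hvf⟩ := triangularGraph_adj.1 (hK.isClique he hf hef)
      exact Finset.disjoint_left.1 hab (Sym2.mem_toFinset.2 hve) (Sym2.mem_toFinset.2 hvf)
  · intro a ha
    simp only [Finset.coe_image, Set.mem_image, Finset.mem_coe] at ha
    obtain ⟨e, he, rfl⟩ := ha
    exact card_toFinset_edge e

/-- The edges of a coclique are pairwise disjoint and cover two vertices each. -/
theorem indepNum_triangularGraph_mul_two_le (n : ℕ) : (triangularGraph n).indepNum * 2 ≤ n := by
  classical
  obtain ⟨A, hA⟩ := (triangularGraph n).exists_isNIndepSet_indepNum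
  have h1 : (A.biUnion fun e => e.1.toFinset).card = ∑ e ∈ A, e.1.toFinset.card := by
    refine Finset.card_biUnion fun e he f hf hef => Finset.disjoint_left.2 fun v hve hvf => ?_
    exact hA.isIndepSet he hf hef (triangularGraph_adj.2
      ⟨hef, v, Sym2.mem_toFinset.1 hve, Sym2.mem_toFinset.1 hvf⟩)
  rw [Finset.sum_congr rfl fun e _ => card_toFinset_edge e, Finset.sum_const, hA.card_eq,
    smul_eq_mul] at h1
  rw [← h1]
  exact (Finset.card_le_univ _).trans_eq (Fintype.card_fin n)

theorem le_cliqueNum_triangularGraph (hn : 1 ≤ n) : n - 1 ≤ (triangularGraph n).cliqueNum := by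
  classical
  let z : Fin n := ⟨0, hn⟩
  let f : {j : Fin n // j ≠ z} → (⊤ : SimpleGraph (Fin n)).edgeSet := fun j =>
    ⟨s(z, j.1), by simpa using j.2.symm⟩
  have hinj : Function.Injective f := fun i j h =>
    Subtype.ext (Sym2.congr_right.1 (congrArg Subtype.val h))
  have hcl : (triangularGraph n).IsClique (Finset.univ.image f : Set _) := by
    rintro _ he _ he' hne
    simp only [Finset.coe_image, Set.mem_image] at he he'
    obtain ⟨i, -, rfl⟩ := he
    obtain ⟨j, -, rfl⟩ := he'
    exact triangularGraph_adj.2 ⟨hne, z, Sym2.mem_mk_left _ _, Sym2.mem_mk_left _ _⟩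
  refine le_trans ?_ (SimpleGraph.IsClique.card_le_cliqueNum (tc := hcl))
  rw [Finset.card_image_of_injective _ hinj, Finset.card_univ, Fintype.card_subtype_compl,
    Fintype.card_fin, Fintype.card_subtype_eq]

/-- The perfect matching that pairs `i` with `k + i` is a coclique. -/
theorem le_indepNum_triangularGraph (k : ℕ) : k ≤ (triangularGraph (k + k)).indepNum := by
  classical
  let f : Fin k → (⊤ : SimpleGraph (Fin (k + k))).edgeSet := fun i =>
    ⟨s(Fin.castAdd k i, Fin.natAdd k i), by
      simp only [SimpleGraph.mem_edgeSet, SimpleGraph.top_adj, ne_eq, Fin.ext_iff, Fin.val_castAdd,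
        Fin.val_natAdd]
      omega⟩
  have hmem : ∀ i j v, v ∈ (f i).1 → v ∈ (f j).1 → i = j := by
    intro i j v hi hj
    simp only [f, Sym2.mem_iff, Fin.ext_iff, Fin.val_castAdd, Fin.val_natAdd] at hi hj
    ext
    omega
  have hinj : Function.Injective f := fun i j h =>
    hmem i j _ (Sym2.mem_mk_left _ _) (h ▸ Sym2.mem_mk_left _ _)
  have hind : (triangularGraph (k + k)).IsIndepSet (Finset.univ.image f : Set _) := by
    rintro _ he _ he' hne hadj
    simp only [Finset.coe_image, Set.mem_image] at he he'
    obtain ⟨i, -, rfl⟩ := he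
    obtain ⟨j, -, rfl⟩ := he'
    obtain ⟨-, v, hi, hj⟩ := triangularGraph_adj.1 hadj
    exact hne (congrArg f (hmem i j v hi hj))
  refine Eq.trans_le ?_ hind.card_le_indepNum
  rw [Finset.card_image_of_injective _ hinj, Finset.card_univ, Fintype.card_fin]

theorem isSeparating_triangularGraph_iff (hn : 4 ≤ n) :
    IsSeparating (triangularGraph n) ↔ Odd n := by
  rw [IsSeparating, card_edgeSet_top, ← Nat.not_even_iff_odd]
  constructor
  · rintro h ⟨k, rfl⟩
    refine absurd h (not_lt.2 (le_trans ?_ (Nat.mul_le_mul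
      (le_cliqueNum_triangularGraph (by omega)) (le_indepNum_triangularGraph k))))
    rw [Nat.choose_two_right]
    refine Nat.div_le_of_le_mul (le_of_eq ?_)
    ring
  · intro h
    obtain ⟨k, rfl⟩ := Nat.not_even_iff_odd.1 h
    have h1 := cliqueNum_triangularGraph_le hn
    have h2 := indepNum_triangularGraph_mul_two_le (2 * k + 1)
    have h3 := Nat.mul_le_mul h1 (show (triangularGraph (2 * k + 1)).indepNum ≤ k by omega)
    refine h3.trans_lt ?_
    rw [Nat.choose_two_right, Nat.add_sub_cancel, Nat.lt_div_iff_mul_lt' ⟨(2 * k + 1) * k, by ring⟩]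
    nlinarith

end TriangularGraph

theorem mainTheorem5 :
    -- (a) triangular graphs
    (∀ n : ℕ, 4 ≤ n → (IsSeparating (triangularGraph n) ↔ Odd n)) ∧
    -- (b) polar graphs
    (∀ (P : Type*) [Finite P] (n : ℕ) (S : PolarSpace P n) (q t : ℕ),
      2 ≤ n → S.HasOrder q t →
        (¬ IsSeparating S.collinearityGraph ↔ ∃ O : Set P, S.IsOvoid O)) ∧
    -- (c) components of the distance-2 graph of the dual polar graph
    (∀ (P : Type*) [Finite P] (S : PolarSpace P 5) (q : ℕ), S.HasOrder q 1 →
      ∀ C : (distanceTwoGraph S.dualPolarGraph).ConnectedComponent,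
        IsSeparating C.toSimpleGraph) := by
  exact ⟨fun _ hn => isSeparating_triangularGraph_iff hn,
    fun _ _ _ _ _ _ hn h => h.not_isSeparating_iff hn,
    fun _ _ _ _ h C => h.isSeparating_component C⟩
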